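/- Consider the non-stationary dueling bandits problem with $K\ge 2$ arms, horizon $T$ and $M\ge 2$ stationary segments $S_1,\dots,S_M$ that partition $\{1,\dots,T\}$ into consecutive intervals. In segment $S_m$ a duel of the arms $(i,j)$ is won by $i$ with probability $p^{(m)}_{i,j}\in[0,1]$, independently of everything else, where $p^{(m)}_{i,j}+p^{(m)}_{j,i}=1$, and there is a Condorcet winner $m^*$, i.e. $p^{(m)}_{m^*,i}>\tfrac12$ for all $i\ne m^*$. Playing $(i,j)$ in $S_m$ costs the binary strong regret $\lceil(\Delta^{(m)}_i+\Delta^{(m)}_j)/2\rceil$ with $\Delta^{(m)}_i=p^{(m)}_{m^*,i}-\tfrac12$. Let $\delta=\min_{m<M}\max_{i,j}|p^{(m+1)}_{i,j}-p^{(m)}_{i,j}|$ be the minimal segmental change, and suppose $\delta>0$. The meta-algorithm MDB (Monitored Dueling Bandits) with even window length $w$, threshold $b$, exploration rate $\gamma$, a black-box (possibly randomized) dueling bandits algorithm $Alg$, and an arbitrary ordering $O$ (counted from $0$) of the pairs $(i,j)$ with $i<j$ works as follows. Initially $\tau=0$. In step $t=1,\dots,T$ put $r=(t-\tau-1)\bmod\lfloor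 K(K-1)/(2\gamma)\rfloor$. If $r<K(K-1)/2$, the $r$-th pair of $O$ is played and the outcome is recorded for that pair; if the pair now has at least $w$ recorded outcomes and the numbers of wins in the older and the newer half of its last $w$ recorded outcomes differ by more than $b$ in absolute value, then $\tau$ is set to $t$, all records are emptied and $Alg$ is reset to its initial state. Otherwise the pair chosen by $Alg$ is played and the outcome is fed to $Alg$ only. Let $\mathbb E[R(T)]$ be the expected cumulative binary strong regret of MDB, and let $R_M(Alg)$ be the sum over $m$ of the expected cumulative binary strong regret that $Alg$ incurs when it is started afresh and run on its own for $|S_m|$ steps with the preferences of $S_m$. Set $C=\log\frac{\sqrt{2T}(2T+1)}{\sqrt M K}$, let $w$ be the smallest even integer $w\ge 0$ with $w\ge 8C/\delta^2$, and put $\gamma=(K-1)\sqrt{Mw/(8T)}$, $b=\sqrt{wC/2}$, $c=\sqrt{2C/w}$. Assume that $|S_m|\ge 2L$ for all $m$, where $L=w\lfloor K(K-1)/(2\gamma)\rfloor$, and that $\gamma\in\left[\frac{K(K-1)}{2T},\frac{K-1}{2}\right]$. Then $b,c>0$ and $\delta\ge\frac{2b}{w}+c$, and $$\mathbb E[R(T)]\le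 A\cdot\frac{K\sqrt{MTC}}{\delta}+R_M(Alg)$$ with a universal constant $A$. Moreover, $$\mathbb E[R(T)]=\mathcal O\!\left(\frac{K\sqrt{MT\log(\delta T/(KM))}}{\delta}\right)+R_M(Alg)$$ in the following sense: for every $\varepsilon>0$ there is a constant $B_\varepsilon$, depending on $\varepsilon$ only, such that whenever $\delta T/(KM)\ge T^{\varepsilon}$, $$\mathbb E[R(T)]\le B_\varepsilon\cdot\frac{K\sqrt{MT\log(\delta T/(KM))}}{\delta}+R_M(Alg).$$ (For fixed $K$, $M$, $\delta$ and $\varepsilon=\tfrac12$ the condition holds for all sufficiently large $T$, so the bound holds as $T\to\infty$ with a universal constant.) -/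

import Mathlib

/-- The Bernoulli law on `Bool` with success probability `p`. -/
noncomputable def bernoulliLaw (p : ℝ) (hp : p ∈ Set.Icc (0 : ℝ) 1) : PMF Bool :=
  PMF.ofFintype (fun x => ENNReal.ofReal (if x then p else 1 - p)) (by
    rw [Fintype.sum_bool, if_pos rfl, if_neg (by decide),
      ← ENNReal.ofReal_add hp.1 (sub_nonneg.2 hp.2), add_sub_cancel, ENNReal.ofReal_one])

/-- The expectation of a real function under a discrete law.  It is only used below for laws of
finite support. -/
noncomputable def expectation {α : Type*} (μ : PMF α) (f : α → ℝ) : ℝ :=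
  ∑' a, (μ a).toReal * f a

/-- A non-stationary dueling bandits problem with `K` arms, horizon `T`, and `N` changepoints,
hence with `M = N + 1` stationary segments, which are indexed by `Fin (N + 1)`. The changepoints
`ν_1 < ... < ν_{M-1}` are the values of `changepoint`. -/
structure DuelingEnv (K T N : ℕ) where
  changepoint : Fin N → ℕ
  changepoint_strictMono : StrictMono changepoint
  one_lt_changepoint : ∀ k, 1 < changepoint k
  changepoint_le : ∀ k, changepoint k ≤ T
  /-- `P m i j` is the probability that arm `i` wins against arm `j` in segment `m`. -/
  P : Fin (N + 1) → Fin K → Fin K → ℝ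
  P_mem : ∀ m i j, P m i j ∈ Set.Icc (0 : ℝ) 1
  P_add : ∀ m i j, P m i j + P m j i = 1
  /-- The Condorcet winner of each segment. -/
  cw : Fin (N + 1) → Fin K
  half_lt_cw : ∀ m i, i ≠ cw m → 1 / 2 < P m (cw m) i

namespace DuelingEnv

variable {K T N : ℕ} (E : DuelingEnv K T N)

/-- The segment containing time step `t`: the number of changepoints that are at most `t`. -/
def segment (t : ℕ) : Fin (N + 1) :=
  ⟨(Finset.univ.filter fun k : Fin N => E.changepoint k ≤ t).card,
    Nat.lt_succ_of_le ((Finset.card_le_univ _).trans_eq (Fintype.card_fin N))⟩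

/-- The length `|S_m|`: the number of time steps `1 ≤ t ≤ T` in segment `m`. -/
def segmentLength (m : Fin (N + 1)) : ℕ :=
  ((Finset.Icc 1 T).filter fun t => E.segment t = m).card

/-- The suboptimality gap of arm `i` in segment `m`. -/
noncomputable def gap (m : Fin (N + 1)) (i : Fin K) : ℝ := E.P m (E.cw m) i - 1 / 2

/-- The instantaneous binary strong regret of a pair of arms in segment `m`. -/
noncomputable def binaryStrongRegret (m : Fin (N + 1)) (a : Fin K × Fin K) : ℤ :=
  ⌈(E.gap m a.1 + E.gap m a.2) / 2⌉

/-- The change at the changepoint between the segments `k` and `k + 1`: the maximal absolute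
change of an entry of the preference matrix. -/
noncomputable def segmentalChange (k : Fin N) : ℝ :=
  ⨆ a : Fin K × Fin K, |E.P k.succ a.1 a.2 - E.P k.castSucc a.1 a.2|

/-- The minimal segmental change `δ`. -/
noncomputable def minimalChange : ℝ := ⨅ k : Fin N, E.segmentalChange k

/-- The law of the outcome of a duel in segment `m`; `true` means that the first arm wins. -/
noncomputable def duel (m : Fin (N + 1)) (a : Fin K × Fin K) : PMF Bool :=
  bernoulliLaw (E.P m a.1 a.2) (E.P_mem m a.1 a.2)

end DuelingEnv

/-- What a dueling bandits algorithm has seen since it was started: the played pairs with the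
outcomes of the duels, latest first. -/
abbrev DuelHistory (K : ℕ) : Type := List ((Fin K × Fin K) × Bool)

/-- A (randomized) dueling bandits algorithm: it chooses the next pair of arms at random, with a
law determined by what it has observed since it was started.  Resetting it empties its history. -/
abbrev DuelingAlg (K : ℕ) : Type := DuelHistory K → PMF (Fin K × Fin K)

/-- The pairs of arms `(a_i, a_j)` with `i < j`. -/
abbrev ArmPair (K : ℕ) : Type := {a : Fin K × Fin K // a.1 < a.2}

namespace DuelingEnv

variable {K T N : ℕ} (E : DuelingEnv K T N)

/-- The joint law of the history and the cumulative binary strong regret of `alg` when it is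
started afresh and run on its own for `n` time steps with the preferences of segment `m`. -/
noncomputable def algLaw (alg : DuelingAlg K) (m : Fin (N + 1)) :
    ℕ → PMF (DuelHistory K × ℤ)
  | 0 => PMF.pure ([], 0)
  | n + 1 =>
    (algLaw alg m n).bind fun s =>
    (alg s.1).bind fun a =>
    (E.duel m a).map fun x => ((a, x) :: s.1, s.2 + E.binaryStrongRegret m a)

/-- The sum over all segments of the expected cumulative binary strong regret that `alg` incurs
when it is run on its own, freshly started, on that segment. -/
noncomputable def algRegret (alg : DuelingAlg K) : ℝ :=
  ∑ m : Fin (N + 1), expectation (E.algLaw alg m (E.segmentLength m)) fun s => (s.2 : ℝ)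

end DuelingEnv

/-- The state of MDB: the time `τ` of the last detection, the outcomes of the detection steps of
each pair since then (latest first, so `n_{i,j}` is the length of the list), and the history of
the black-box algorithm since then. -/
structure MDBState (K : ℕ) where
  τ : ℕ
  obs : ArmPair K → List Bool
  hist : DuelHistory K

/-- The state of MDB after a (re)start, the last detection being at time `τ`. -/
def MDBState.fresh (K τ : ℕ) : MDBState K := ⟨τ, fun _ => [], []⟩

/-- The number of time steps in a cycle of MDB with exploration rate `γ`. -/
noncomputable def mdbCycle (K : ℕ) (γ : ℝ) : ℕ := ⌊(K : ℝ) * (K - 1) / (2 * γ)⌋₊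

/-- The changepoint test on a list of outcomes (latest first): there are at least `w` of them, and
the numbers of wins in the older and the newer half of the last `w` differ by more than `b`. -/
def mdbAlarm (w : ℕ) (b : ℝ) (l : List Bool) : Prop :=
  w ≤ l.length ∧
    b < |((((l.drop (w / 2)).take (w / 2)).count true : ℕ) : ℝ) -
          (((l.take (w / 2)).count true : ℕ) : ℝ)|

namespace DuelingEnv

variable {K T N : ℕ} (E : DuelingEnv K T N)

open Classical in
/-- Time step `t` of MDB in state `s`, with window length `w`, threshold `b`, exploration rate `γ`
and ordering `O` of the pairs: the joint law of the next state and of the pair played. -/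
noncomputable def mdbStep (O : Fin (K * (K - 1) / 2) ≃ ArmPair K) (w : ℕ) (b γ : ℝ)
    (alg : DuelingAlg K) (t : ℕ) (s : MDBState K) : PMF (MDBState K × (Fin K × Fin K)) :=
  if h : (t - s.τ - 1) % mdbCycle K γ < K * (K - 1) / 2 then
    let a : ArmPair K := O ⟨(t - s.τ - 1) % mdbCycle K γ, h⟩
    (E.duel (E.segment t) a.1).map fun x =>
      (if mdbAlarm w b (x :: s.obs a) then MDBState.fresh K t
        else { s with obs := Function.update s.obs a (x :: s.obs a) }, a.1)
  else
    (alg s.hist).bind fun a =>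
    (E.duel (E.segment t) a).map fun x => ({ s with hist := (a, x) :: s.hist }, a)

/-- The joint law of the state and the cumulative binary strong regret of MDB after the time
steps `1, ..., n`. -/
noncomputable def mdbLaw (O : Fin (K * (K - 1) / 2) ≃ ArmPair K) (w : ℕ) (b γ : ℝ)
    (alg : DuelingAlg K) : ℕ → PMF (MDBState K × ℤ)
  | 0 => PMF.pure (MDBState.fresh K 0, 0)
  | n + 1 =>
    (mdbLaw O w b γ alg n).bind fun s =>
    (E.mdbStep O w b γ alg (n + 1) s.1).map fun q =>
      (q.1, s.2 + E.binaryStrongRegret (E.segment (n + 1)) q.2)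

/-- The expected cumulative binary strong regret of MDB over the horizon `T`. -/
noncomputable def mdbRegret (O : Fin (K * (K - 1) / 2) ≃ ArmPair K) (w : ℕ) (b γ : ℝ)
    (alg : DuelingAlg K) : ℝ :=
  expectation (E.mdbLaw O w b γ alg T) fun s => (s.2 : ℝ)

end DuelingEnv

/-! The regret is studied backwards in time: `mdbValue` is the expected regret still to come in a
given state, so every conditional expectation becomes one step of a recursion. Write `w = 2h`; a
restart leaves MDB with empty records and a fresh copy of the black box.

Within one segment, after a restart, four costs arise (`mdbValue_le_of_fresh`). On its own steps MDB
moves exactly as the black box does alone, and detection steps leave the black box untouched, so it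
contributes at most its stand-alone regret on the segment. Each detection step costs at most 1. A
false alarm is charged the whole horizon `T`, and a union bound runs over the tests. What remains is
the value at the end of the segment.

At that point the pair `c` that changes most at the coming changepoint has at least `h` records from
the old segment. After `h` more cycles its window consists of `h` old and `h` new outcomes, and
either the test of `c` fires or the change is missed. A miss is charged `T`; the delay costs at most
`h` cycles; an alarm of any pair in the meantime is a restart early in the new segment
(`mdbValue_le_of_stale`). Backward induction over the segments adds these costs up
(`mdbValue_fresh_le_sum`, `mdbRegret_le`).

Both error probabilities are Chernoff bounds: `2 exp(-b²/h)` for a false alarm and `exp(-h c²)` for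
a miss when the change is at least `b/h + c`. The parameters make both exponents equal to `C`, and
`C` is such that `T² exp(-C)` is at most of order `K√(MT)`. The value of `γ` balances exploration,
of order `T γ`, against the delays, of order `M w K² / γ`; since `w` is of order `C/δ²`, both are at
most of order `K√(MTC)/δ`. Finally `C ≤ 3 log T` allows the logarithm to be replaced. -/

/-! ### Expectations under laws of finite support. -/

theorem expectation_eq_sum {α : Type*} (μ : PMF α) (f : α → ℝ) (S : Finset α)
    (hS : μ.support ⊆ S) : expectation μ f = ∑ a ∈ S, (μ a).toReal * f a := by
  unfold expectation
  refine tsum_eq_sum fun a ha => ?_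
  have h : μ a = 0 := by
    by_contra h
    exact ha (hS ((PMF.mem_support_iff _ _).2 h))
  simp [h]

theorem expectation_pure {α : Type*} (a : α) (f : α → ℝ) : expectation (PMF.pure a) f = f a := by
  rw [expectation_eq_sum _ _ {a} (by simp)]
  simp

/-- The tower property. Finite supports turn all sums into finite ones that may be interchanged;
without summability the real `tsum` would take its default value 0. -/
theorem expectation_bind {α β : Type*} (μ : PMF α) (κ : α → PMF β) (f : β → ℝ)
    (hμ : μ.support.Finite) (hκ : ∀ a, (κ a).support.Finite) :
    expectation (μ.bind κ) f = expectation μ fun a => expectation (κ a) f := by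
  classical
  set S := hμ.toFinset with hS
  set U := S.biUnion fun a => (hκ a).toFinset with hU
  have hμS : μ.support ⊆ S := by simp [hS]
  have hκU : ∀ a ∈ S, (κ a).support ⊆ U := fun a ha b hb => by
    simp only [hU, Finset.coe_biUnion, Set.mem_iUnion]
    exact ⟨a, ha, by simpa using hb⟩
  have hbU : (μ.bind κ).support ⊆ U := by
    intro b hb
    rw [PMF.mem_support_bind_iff] at hb
    obtain ⟨a, ha, hb⟩ := hb
    exact hκU a (hμS ha) hb
  rw [expectation_eq_sum _ _ U hbU, expectation_eq_sum _ _ S hμS]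
  have hb : ∀ b, ((μ.bind κ) b).toReal = ∑ a ∈ S, (μ a).toReal * (κ a b).toReal := by
    intro b
    rw [PMF.bind_apply, tsum_eq_sum (s := S), ENNReal.toReal_sum]
    · simp [ENNReal.toReal_mul]
    · exact fun a _ => ENNReal.mul_ne_top (PMF.apply_ne_top _ _) (PMF.apply_ne_top _ _)
    · intro a ha
      have h : μ a = 0 := by
        by_contra h
        exact ha (hμS ((PMF.mem_support_iff _ _).2 h))
      simp [h]
  simp_rw [hb, Finset.sum_mul]
  rw [Finset.sum_comm]
  refine Finset.sum_congr rfl fun a ha => ?_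
  rw [expectation_eq_sum _ _ U (hκU a ha), Finset.mul_sum]
  exact Finset.sum_congr rfl fun b _ => by ring

theorem support_bind_finite {α β : Type*} (μ : PMF α) (κ : α → PMF β)
    (hμ : μ.support.Finite) (hκ : ∀ a, (κ a).support.Finite) : (μ.bind κ).support.Finite := by
  rw [PMF.support_bind]
  exact hμ.biUnion fun a _ => hκ a

theorem support_map_finite {α β : Type*} (μ : PMF α) (g : α → β)
    (hμ : μ.support.Finite) : (μ.map g).support.Finite := by
  rw [PMF.support_map]
  exact hμ.image g

theorem expectation_map {α β : Type*} (μ : PMF α) (g : α → β) (f : β → ℝ)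
    (hμ : μ.support.Finite) : expectation (μ.map g) f = expectation μ fun a => f (g a) := by
  rw [← PMF.bind_pure_comp, expectation_bind _ _ _ hμ fun a => by simp]
  simp [expectation_pure]

theorem sum_toReal_eq_one {α : Type*} (μ : PMF α) (S : Finset α) (hS : μ.support ⊆ S) :
    ∑ a ∈ S, (μ a).toReal = 1 := by
  have h : ∑' a, μ a = ∑ a ∈ S, μ a := tsum_eq_sum fun a ha => by
    by_contra h
    exact ha (hS ((PMF.mem_support_iff _ _).2 h))
  rw [← ENNReal.toReal_sum fun a _ => PMF.apply_ne_top _ _, ← h, PMF.tsum_coe,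
    ENNReal.toReal_one]

theorem expectation_mono {α : Type*} (μ : PMF α) (f g : α → ℝ) (hμ : μ.support.Finite)
    (h : ∀ a, f a ≤ g a) : expectation μ f ≤ expectation μ g := by
  rw [expectation_eq_sum μ f hμ.toFinset (by simp), expectation_eq_sum μ g hμ.toFinset (by simp)]
  exact Finset.sum_le_sum fun a _ => mul_le_mul_of_nonneg_left (h a) ENNReal.toReal_nonneg

theorem expectation_const_add {α : Type*} (μ : PMF α) (c : ℝ) (f : α → ℝ)
    (hμ : μ.support.Finite) : expectation μ (fun a => c + f a) = c + expectation μ f := by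
  have hS : μ.support ⊆ hμ.toFinset := by simp
  rw [expectation_eq_sum μ _ hμ.toFinset hS, expectation_eq_sum μ f hμ.toFinset hS]
  simp_rw [mul_add, Finset.sum_add_distrib, ← Finset.sum_mul]
  rw [sum_toReal_eq_one μ _ hS, one_mul]

theorem expectation_const {α : Type*} (μ : PMF α) (c : ℝ)
    (hμ : μ.support.Finite) : expectation μ (fun _ => c) = c := by
  have := expectation_const_add μ c (fun _ => 0) hμ
  simpa [expectation] using this

theorem expectation_bernoulliLaw (p : ℝ) (hp : p ∈ Set.Icc (0 : ℝ) 1) (f : Bool → ℝ) :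
    expectation (bernoulliLaw p hp) f = p * f true + (1 - p) * f false := by
  rw [expectation_eq_sum _ _ Finset.univ fun _ _ => Finset.mem_coe.2 (Finset.mem_univ _),
    Fintype.sum_bool]
  simp [bernoulliLaw, PMF.ofFintype_apply, ENNReal.toReal_ofReal, hp.1, hp.2]

/-! ### Regret as a backward value function. -/

namespace DuelingEnv

variable {K T N : ℕ} (E : DuelingEnv K T N)

theorem gap_mem (m : Fin (N + 1)) (i : Fin K) : E.gap m i ∈ Set.Icc (0 : ℝ) (1 / 2) := by
  have h := E.P_mem m (E.cw m) i
  refine ⟨?_, by unfold gap; linarith [h.2]⟩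
  unfold gap
  by_cases hi : i = E.cw m
  · subst hi
    linarith [E.P_add m (E.cw m) (E.cw m)]
  · linarith [E.half_lt_cw m i hi]

theorem binaryStrongRegret_nonneg (m : Fin (N + 1)) (a : Fin K × Fin K) :
    (0 : ℝ) ≤ E.binaryStrongRegret m a := by
  have h1 := E.gap_mem m a.1
  have h2 := E.gap_mem m a.2
  exact_mod_cast Int.ceil_nonneg (by linarith [h1.1, h2.1])

theorem binaryStrongRegret_le_one (m : Fin (N + 1)) (a : Fin K × Fin K) :
    (E.binaryStrongRegret m a : ℝ) ≤ 1 := by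
  have h1 := E.gap_mem m a.1
  have h2 := E.gap_mem m a.2
  have : E.binaryStrongRegret m a ≤ 1 := Int.ceil_le.2 (by push_cast; linarith [h1.2, h2.2])
  exact_mod_cast this

/-- The expected regret of `alg` with the history `l` over `n` further steps in segment `m`. -/
noncomputable def algValue (alg : DuelingAlg K) (m : Fin (N + 1)) : ℕ → DuelHistory K → ℝ
  | 0, _ => 0
  | n + 1, l => expectation (alg l) fun a => E.binaryStrongRegret m a +
      (E.P m a.1 a.2 * algValue alg m n ((a, true) :: l) +
        (1 - E.P m a.1 a.2) * algValue alg m n ((a, false) :: l))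

theorem average_mono {p x y x' y' : ℝ} (hp : p ∈ Set.Icc (0 : ℝ) 1) (hx : x ≤ x') (hy : y ≤ y') :
    p * x + (1 - p) * y ≤ p * x' + (1 - p) * y' :=
  add_le_add (mul_le_mul_of_nonneg_left hx hp.1)
    (mul_le_mul_of_nonneg_left hy (sub_nonneg.2 hp.2))

/-- Detection steps do not advance the black box, so inside MDB it runs for fewer steps than the
segment has. Monotonicity lets these be compared with a full run. -/
theorem algValue_le_succ (alg : DuelingAlg K) (m : Fin (N + 1)) (n : ℕ) :
    ∀ l, E.algValue alg m n l ≤ E.algValue alg m (n + 1) l := by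
  induction n with
  | zero =>
    intro l
    have h := expectation_mono (alg l) (fun _ => 0) _ (Set.toFinite _)
      (fun a => E.binaryStrongRegret_nonneg m a)
    rw [expectation_const _ _ (Set.toFinite _)] at h
    simpa [algValue] using h
  | succ n ih =>
    intro l
    exact expectation_mono _ _ _ (Set.toFinite _) fun a =>
      add_le_add le_rfl (average_mono (E.P_mem m _ _) (ih _) (ih _))

theorem algValue_mono (alg : DuelingAlg K) (m : Fin (N + 1)) (l : DuelHistory K) :
    Monotone fun n => E.algValue alg m n l :=
  monotone_nat_of_le_succ fun n => E.algValue_le_succ alg m n l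

theorem algValue_nonneg (alg : DuelingAlg K) (m : Fin (N + 1)) (n : ℕ) (l : DuelHistory K) :
    0 ≤ E.algValue alg m n l :=
  E.algValue_mono alg m l (Nat.zero_le n)

theorem algLaw_support_finite (alg : DuelingAlg K) (m : Fin (N + 1)) (n : ℕ) :
    (E.algLaw alg m n).support.Finite := by
  induction n with
  | zero => simp [algLaw]
  | succ n ih =>
    exact support_bind_finite _ _ ih fun s => support_bind_finite _ _ (Set.toFinite _)
      fun a => support_map_finite _ _ (Set.toFinite _)

/-- Regret so far plus value to come is a martingale. The case `k = 0` identifies the forward law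
with the backward recursion. -/
theorem expectation_algLaw_add (alg : DuelingAlg K) (m : Fin (N + 1)) (n : ℕ) :
    ∀ k, expectation (E.algLaw alg m n) (fun s => (s.2 : ℝ) + E.algValue alg m k s.1) =
      E.algValue alg m (n + k) [] := by
  induction n with
  | zero => intro k; simp [algLaw, expectation_pure]
  | succ n ih =>
    intro k
    rw [algLaw, expectation_bind _ _ _ (E.algLaw_support_finite alg m n)
      fun s => support_bind_finite _ _ (Set.toFinite _)
        fun a => support_map_finite _ _ (Set.toFinite _)]
    rw [show n + 1 + k = n + (k + 1) by ring, ← ih (k + 1)]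
    congr 1
    funext s
    rw [expectation_bind _ _ _ (Set.toFinite _) fun a => support_map_finite _ _ (Set.toFinite _),
      algValue, ← expectation_const_add _ _ _ (Set.toFinite _)]
    congr 1
    funext a
    rw [expectation_map _ _ _ (Set.toFinite _), duel, expectation_bernoulliLaw]
    push_cast
    ring

theorem expectation_algLaw (alg : DuelingAlg K) (m : Fin (N + 1)) (n : ℕ) :
    expectation (E.algLaw alg m n) (fun s => (s.2 : ℝ)) = E.algValue alg m n [] := by
  have h := E.expectation_algLaw_add alg m n 0
  simpa [algValue] using h

theorem algRegret_nonneg (alg : DuelingAlg K) : 0 ≤ E.algRegret alg :=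
  Finset.sum_nonneg fun m _ => by
    rw [expectation_algLaw]
    exact E.algValue_nonneg alg m _ _

section MDB

variable (O : Fin (K * (K - 1) / 2) ≃ ArmPair K) (w : ℕ) (b γ : ℝ) (alg : DuelingAlg K)

/-- The expected regret of MDB in state `s` at time `t` over `n` further steps. -/
noncomputable def mdbValue : ℕ → ℕ → MDBState K → ℝ
  | 0, _, _ => 0
  | n + 1, t, s => expectation (E.mdbStep O w b γ alg (t + 1) s) fun q =>
      E.binaryStrongRegret (E.segment (t + 1)) q.2 + mdbValue n (t + 1) q.1

theorem mdbStep_support_finite (t : ℕ) (s : MDBState K) :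
    (E.mdbStep O w b γ alg t s).support.Finite := by
  unfold mdbStep
  split_ifs
  · exact support_map_finite _ _ (Set.toFinite _)
  · exact support_bind_finite _ _ (Set.toFinite _)
        fun a => support_map_finite _ _ (Set.toFinite _)

theorem mdbLaw_support_finite (n : ℕ) : (E.mdbLaw O w b γ alg n).support.Finite := by
  induction n with
  | zero => simp [mdbLaw]
  | succ n ih =>
    exact support_bind_finite _ _ ih fun s =>
      support_map_finite _ _ (E.mdbStep_support_finite O w b γ alg _ _)

theorem expectation_mdbLaw_add (n : ℕ) : ∀ k,
    expectation (E.mdbLaw O w b γ alg n)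
      (fun s => (s.2 : ℝ) + E.mdbValue O w b γ alg k n s.1) =
      E.mdbValue O w b γ alg (n + k) 0 (MDBState.fresh K 0) := by
  induction n with
  | zero => intro k; simp [mdbLaw, expectation_pure]
  | succ n ih =>
    intro k
    have hf := E.mdbStep_support_finite O w b γ alg
    rw [mdbLaw, expectation_bind _ _ _ (E.mdbLaw_support_finite O w b γ alg n)
      fun s => support_map_finite _ _ (hf _ _)]
    rw [show n + 1 + k = n + (k + 1) by ring, ← ih (k + 1)]
    congr 1
    funext s
    rw [expectation_map _ _ _ (hf _ _), mdbValue, ← expectation_const_add _ _ _ (hf _ _)]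
    congr 1
    funext a
    push_cast
    ring

theorem mdbRegret_eq_mdbValue :
    E.mdbRegret O w b γ alg = E.mdbValue O w b γ alg T 0 (MDBState.fresh K 0) := by
  have h := E.expectation_mdbLaw_add O w b γ alg T 0
  simpa [mdbValue, mdbRegret] using h

theorem mdbValue_le (n : ℕ) : ∀ t s, E.mdbValue O w b γ alg n t s ≤ n := by
  induction n with
  | zero => intro t s; simp [mdbValue]
  | succ n ih =>
    intro t s
    have hf := E.mdbStep_support_finite O w b γ alg (t + 1) s
    rw [mdbValue, ← expectation_const _ ((n + 1 : ℕ) : ℝ) hf]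
    refine expectation_mono _ _ _ hf fun q => ?_
    push_cast
    linarith [E.binaryStrongRegret_le_one (E.segment (t + 1)) q.2, ih (t + 1) q.1]

open Classical in
theorem mdbValue_succ_of_lt (n t : ℕ) (s : MDBState K)
    (h : (t - s.τ) % mdbCycle K γ < K * (K - 1) / 2) (a : ArmPair K)
    (ha : a = O ⟨(t - s.τ) % mdbCycle K γ, h⟩) :
    E.mdbValue O w b γ alg (n + 1) t s =
      E.binaryStrongRegret (E.segment (t + 1)) a.1 +
      (E.P (E.segment (t + 1)) a.1.1 a.1.2 * E.mdbValue O w b γ alg n (t + 1)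
        (if mdbAlarm w b (true :: s.obs a) then MDBState.fresh K (t + 1)
          else { s with obs := Function.update s.obs a (true :: s.obs a) }) +
      (1 - E.P (E.segment (t + 1)) a.1.1 a.1.2) * E.mdbValue O w b γ alg n (t + 1)
        (if mdbAlarm w b (false :: s.obs a) then MDBState.fresh K (t + 1)
          else { s with obs := Function.update s.obs a (false :: s.obs a) })) := by
  subst ha
  -- The value at time `t` plays step `t + 1`, whose position in the cycle is therefore `t - τ`.
  have e : t + 1 - s.τ - 1 = t - s.τ := by omega
  rw [mdbValue, mdbStep]
  simp only [e]
  rw [dif_pos h, expectation_map _ _ _ (Set.toFinite _), duel, expectation_bernoulliLaw]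
  ring

theorem mdbValue_succ_of_not_lt (n t : ℕ) (s : MDBState K)
    (h : ¬ (t - s.τ) % mdbCycle K γ < K * (K - 1) / 2) :
    E.mdbValue O w b γ alg (n + 1) t s =
      expectation (alg s.hist) fun a => E.binaryStrongRegret (E.segment (t + 1)) a +
      (E.P (E.segment (t + 1)) a.1 a.2 * E.mdbValue O w b γ alg n (t + 1)
        { s with hist := (a, true) :: s.hist } +
      (1 - E.P (E.segment (t + 1)) a.1 a.2) * E.mdbValue O w b γ alg n (t + 1)
        { s with hist := (a, false) :: s.hist }) := by
  have e : t + 1 - s.τ - 1 = t - s.τ := by omega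
  rw [mdbValue, mdbStep]
  simp only [e]
  rw [dif_neg h, expectation_bind _ _ _ (Set.toFinite _)
    fun a => support_map_finite _ _ (Set.toFinite _)]
  congr 1
  funext a
  rw [expectation_map _ _ _ (Set.toFinite _), duel, expectation_bernoulliLaw]
  ring

end MDB

end DuelingEnv

/-! ### Chernoff bounds for the changepoint test. -/

open MeasureTheory in
/-- Hoeffding's lemma for a Bernoulli variable. -/
theorem bernoulli_mgf_le {p : ℝ} (hp : p ∈ Set.Icc (0 : ℝ) 1) (t : ℝ) :
    p * Real.exp t + (1 - p) ≤ Real.exp (t * p + t ^ 2 / 8) := by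
  set X : Bool → ℝ := fun x => if x then 1 else 0 with hX
  have hint : ∀ f : Bool → ℝ, ∫ x, f x ∂(bernoulliLaw p hp).toMeasure =
      p * f true + (1 - p) * f false := by
    intro f
    rw [PMF.integral_eq_sum, Fintype.sum_bool]
    simp [bernoulliLaw, PMF.ofFintype_apply, ENNReal.toReal_ofReal, hp.1, hp.2]
  have h := ProbabilityTheory.hasSubgaussianMGF_of_mem_Icc
    (μ := (bernoulliLaw p hp).toMeasure) (X := X) (a := 0) (b := 1)
    (measurable_of_finite X).aemeasurable
    (Filter.Eventually.of_forall fun x => by cases x <;> simp [hX])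
  have h' := h.mgf_le t
  rw [ProbabilityTheory.mgf, hint, hint] at h'
  simp only [hX, if_true, Bool.false_eq_true, if_false] at h'
  have e1 : Real.exp (t * (1 - (p * 1 + (1 - p) * 0))) = Real.exp t * Real.exp (-(t * p)) := by
    rw [← Real.exp_add]; ring_nf
  have e2 : Real.exp (t * (0 - (p * 1 + (1 - p) * 0))) = Real.exp (-(t * p)) := by
    ring_nf
  rw [e1, e2] at h'
  have e3 : (((‖(1 : ℝ) - 0‖₊ / 2) ^ 2 : NNReal) : ℝ) * t ^ 2 / 2 = t ^ 2 / 8 := by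
    push_cast
    norm_num
    ring
  rw [e3] at h'
  rw [Real.exp_add]
  have e4 : Real.exp (t * p) * Real.exp (-(t * p)) = 1 := by
    rw [← Real.exp_add, add_neg_cancel, Real.exp_zero]
  calc p * Real.exp t + (1 - p)
      = Real.exp (t * p) * (p * (Real.exp t * Real.exp (-(t * p))) +
          (1 - p) * Real.exp (-(t * p))) := by
        linear_combination (-(p * Real.exp t) - (1 - p)) * e4
    _ ≤ _ := mul_le_mul_of_nonneg_left h' (Real.exp_nonneg _)

/-- The expectation of `f (x_n :: ... :: x_1 :: l)` for independent Bernoulli variables `x_i` with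
success probability `p`. -/
noncomputable def sampleMean (p : ℝ) : ℕ → List Bool → (List Bool → ℝ) → ℝ
  | 0, l, f => f l
  | n + 1, l, f => p * sampleMean p n (true :: l) f + (1 - p) * sampleMean p n (false :: l) f

theorem sampleMean_mono {p : ℝ} (hp : p ∈ Set.Icc (0 : ℝ) 1) {f g : List Bool → ℝ} (n : ℕ) :
    ∀ l, (∀ v : List Bool, v.length = n → f (v ++ l) ≤ g (v ++ l)) →
      sampleMean p n l f ≤ sampleMean p n l g := by
  induction n with
  | zero => intro l h; exact h [] rfl
  | succ n ih =>
    intro l h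
    refine DuelingEnv.average_mono hp (ih _ fun v hv => ?_) (ih _ fun v hv => ?_)
    · have := h (v ++ [true]) (by simp [hv])
      simpa using this
    · have := h (v ++ [false]) (by simp [hv])
      simpa using this

theorem sampleMean_const (p c : ℝ) (n : ℕ) : ∀ l, sampleMean p n l (fun _ => c) = c := by
  induction n with
  | zero => intro l; rfl
  | succ n ih => intro l; rw [sampleMean, ih, ih]; ring

theorem sampleMean_nonneg {p : ℝ} (hp : p ∈ Set.Icc (0 : ℝ) 1) {f : List Bool → ℝ}
    (hf : ∀ l, 0 ≤ f l) (n : ℕ) (l : List Bool) : 0 ≤ sampleMean p n l f := by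
  rw [← sampleMean_const p 0 n l]
  exact sampleMean_mono hp n l fun v _ => hf _

theorem sampleMean_le_of_le {p : ℝ} (hp : p ∈ Set.Icc (0 : ℝ) 1) {f : List Bool → ℝ} {c : ℝ}
    (n : ℕ) (l : List Bool) (hf : ∀ v : List Bool, v.length = n → f (v ++ l) ≤ c) :
    sampleMean p n l f ≤ c := by
  rw [← sampleMean_const p c n l]
  exact sampleMean_mono hp n l hf

theorem sampleMean_add (p : ℝ) (f : List Bool → ℝ) (n k : ℕ) :
    ∀ l, sampleMean p (n + k) l f = sampleMean p n l fun l' => sampleMean p k l' f := by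
  induction n with
  | zero => intro l; rw [Nat.zero_add]; rfl
  | succ n ih =>
    intro l
    rw [show n + 1 + k = (n + k) + 1 by ring, sampleMean, sampleMean, ih, ih]

theorem sampleMean_const_mul (p c : ℝ) (f : List Bool → ℝ) (n : ℕ) :
    ∀ l, sampleMean p n l (fun l' => c * f l') = c * sampleMean p n l f := by
  induction n with
  | zero => intro l; rfl
  | succ n ih => intro l; rw [sampleMean, sampleMean, ih, ih]; ring

theorem sampleMean_add_fun (p : ℝ) (f g : List Bool → ℝ) (n : ℕ) :
    ∀ l, sampleMean p n l (fun l' => f l' + g l') = sampleMean p n l f + sampleMean p n l g := by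
  induction n with
  | zero => intro l; rfl
  | succ n ih => intro l; rw [sampleMean, sampleMean, sampleMean, ih, ih]; ring

theorem sampleMean_exp_count (p t : ℝ) (n : ℕ) : ∀ l : List Bool,
    sampleMean p n l (fun l' => Real.exp (t * (l'.count true : ℕ))) =
      Real.exp (t * (l.count true : ℕ)) * (p * Real.exp t + (1 - p)) ^ n := by
  induction n with
  | zero => intro l; simp [sampleMean]
  | succ n ih =>
    intro l
    rw [sampleMean, ih, ih, List.count_cons_self, List.count_cons_of_ne (by decide)]
    push_cast
    rw [mul_add, Real.exp_add, mul_one]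
    ring

/-- The Chernoff bound for the difference between the numbers of wins in two samples of size `h`
with success probabilities `p` and `q`. -/
theorem sampleMean_exp_count_sub_le {p q : ℝ} (hp : p ∈ Set.Icc (0 : ℝ) 1)
    (hq : q ∈ Set.Icc (0 : ℝ) 1) (t a : ℝ) (h : ℕ) (l : List Bool) :
    sampleMean p h l (fun l' => sampleMean q h l' fun l'' =>
      Real.exp (t * (2 * (l'.count true : ℕ) - (l''.count true : ℕ) - (l.count true : ℕ)) + a)) ≤
      Real.exp (h * t * (p - q) + h * t ^ 2 / 4 + a) := by
  have e1 : ∀ l' : List Bool, sampleMean q h l' (fun l'' =>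
      Real.exp (t * (2 * (l'.count true : ℕ) - (l''.count true : ℕ) - (l.count true : ℕ)) + a)) =
      (Real.exp (a - t * (l.count true : ℕ)) * (q * Real.exp (-t) + (1 - q)) ^ h) *
        Real.exp (t * (l'.count true : ℕ)) := by
    intro l'
    have : (fun l'' : List Bool => Real.exp (t * (2 * (l'.count true : ℕ) -
        (l''.count true : ℕ) - (l.count true : ℕ)) + a)) = fun l'' =>
        Real.exp (2 * t * (l'.count true : ℕ) - t * (l.count true : ℕ) + a) *
          Real.exp (-t * (l''.count true : ℕ)) := by
      funext l''
      rw [← Real.exp_add]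
      ring_nf
    rw [this, sampleMean_const_mul, sampleMean_exp_count]
    -- The newer sample starts from the count of `l'`, which lowers the coefficient of that count
    -- from `2t` to `t`; the average over the older sample is then again a Bernoulli moment.
    have e : Real.exp (2 * t * (l'.count true : ℕ) - t * (l.count true : ℕ) + a) *
        Real.exp (-t * (l'.count true : ℕ)) =
        Real.exp (a - t * (l.count true : ℕ)) * Real.exp (t * (l'.count true : ℕ)) := by
      rw [← Real.exp_add, ← Real.exp_add]
      ring_nf
    linear_combination (q * Real.exp (-t) + (1 - q)) ^ h * e
  simp_rw [e1]
  rw [sampleMean_const_mul, sampleMean_exp_count]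
  have hA : 0 ≤ p * Real.exp t + (1 - p) :=
    add_nonneg (mul_nonneg hp.1 (Real.exp_nonneg _)) (sub_nonneg.2 hp.2)
  have hB : 0 ≤ q * Real.exp (-t) + (1 - q) :=
    add_nonneg (mul_nonneg hq.1 (Real.exp_nonneg _)) (sub_nonneg.2 hq.2)
  have e : Real.exp (a - t * (l.count true : ℕ)) * Real.exp (t * (l.count true : ℕ)) =
      Real.exp a := by
    rw [← Real.exp_add, sub_add_cancel]
  calc _ = Real.exp a * ((p * Real.exp t + (1 - p)) ^ h *
        (q * Real.exp (-t) + (1 - q)) ^ h) := by rw [← e]; ring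
    _ ≤ Real.exp a * (Real.exp (t * p + t ^ 2 / 8) ^ h *
        Real.exp (-t * q + (-t) ^ 2 / 8) ^ h) := by
      have h1 := bernoulli_mgf_le hp t
      have h2 := bernoulli_mgf_le hq (-t)
      gcongr
    _ = _ := by
      rw [← Real.exp_nat_mul, ← Real.exp_nat_mul, ← Real.exp_add, ← Real.exp_add]
      ring_nf

open Classical in
/-- The indicator function of the lists on which the changepoint test raises an alarm. -/
noncomputable def alarmIndicator (w : ℕ) (b : ℝ) (l : List Bool) : ℝ :=
  if mdbAlarm w b l then 1 else 0

theorem alarmIndicator_nonneg (w : ℕ) (b : ℝ) (l : List Bool) : 0 ≤ alarmIndicator w b l := by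
  unfold alarmIndicator
  split_ifs <;> norm_num

theorem alarmIndicator_le_one (w : ℕ) (b : ℝ) (l : List Bool) : alarmIndicator w b l ≤ 1 := by
  unfold alarmIndicator
  split_ifs <;> norm_num

/-- Older wins minus newer wins is a second difference of the cumulative counts at the times before,
between and after the two halves. In this form it fits the nested averages of
`sampleMean_exp_count_sub_le`. -/
theorem mdbAlarm_append_iff {h : ℕ} {b : ℝ} {u v l : List Bool} (hu : u.length = h)
    (hv : v.length = h) : mdbAlarm (2 * h) b (u ++ (v ++ l)) ↔
      b < |(2 * ((v ++ l).count true : ℕ) - ((u ++ (v ++ l)).count true : ℕ) -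
        (l.count true : ℕ) : ℝ)| := by
  have e : 2 * h / 2 = h := by omega
  unfold mdbAlarm
  rw [e, List.drop_left' hu, List.take_left' hu, List.take_left' hv]
  have hl : 2 * h ≤ (u ++ (v ++ l)).length := by simp; omega
  simp only [hl, true_and, List.count_append, Nat.cast_add]
  ring_nf

/-- Two-sided Markov inequality for the exponential moments with `t = ±2b/h`; `2b/h` minimizes `h
t²/4 - t b`. The two signs give the factor 2. -/
theorem sampleMean_alarm_le {p : ℝ} (hp : p ∈ Set.Icc (0 : ℝ) 1) {h : ℕ} (hh : 0 < h) {b : ℝ}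
    (hb : 0 ≤ b) (l : List Bool) :
    sampleMean p h l (fun l' => sampleMean p h l' (alarmIndicator (2 * h) b)) ≤
      2 * Real.exp (-(b ^ 2 / h)) := by
  have hh' : (0 : ℝ) < h := by exact_mod_cast hh
  have key := fun t => sampleMean_exp_count_sub_le hp hp t (-(2 * b ^ 2 / h)) h l
  have k1 := key (2 * b / h)
  have k2 := key (-(2 * b / h))
  have e1 : (h : ℝ) * (2 * b / h) * (p - p) + h * (2 * b / h) ^ 2 / 4 + -(2 * b ^ 2 / h) =
      -(b ^ 2 / h) := by
    field_simp; ring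
  have e2 : (h : ℝ) * -(2 * b / h) * (p - p) + h * (-(2 * b / h)) ^ 2 / 4 + -(2 * b ^ 2 / h) =
      -(b ^ 2 / h) := by
    field_simp; ring
  rw [e1] at k1
  rw [e2] at k2
  refine le_trans ?_ ((add_le_add k1 k2).trans_eq (two_mul _).symm)
  rw [← sampleMean_add_fun]
  refine sampleMean_mono hp _ _ fun v hv => ?_
  rw [← sampleMean_add_fun]
  refine sampleMean_mono hp _ _ fun u hu => ?_
  unfold alarmIndicator
  split_ifs with ha
  · rw [mdbAlarm_append_iff hu hv] at ha
    have hc : 0 ≤ 2 * b / h := by positivity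
    have e : 2 * b / h * b = 2 * b ^ 2 / h := by ring
    rcases lt_abs.1 ha with ha | ha
    · have := mul_le_mul_of_nonneg_left ha.le hc
      have h1 := Real.one_le_exp (x := 2 * b / h * (2 * ((v ++ l).count true : ℕ) -
        ((u ++ (v ++ l)).count true : ℕ) - (l.count true : ℕ)) + -(2 * b ^ 2 / h)) (by linarith)
      have h2 := Real.exp_nonneg (-(2 * b / h) * (2 * ((v ++ l).count true : ℕ) -
        ((u ++ (v ++ l)).count true : ℕ) - (l.count true : ℕ)) + -(2 * b ^ 2 / h))
      linarith
    · have := mul_le_mul_of_nonneg_left ha.le hc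
      have h1 := Real.one_le_exp (x := -(2 * b / h) * (2 * ((v ++ l).count true : ℕ) -
        ((u ++ (v ++ l)).count true : ℕ) - (l.count true : ℕ)) + -(2 * b ^ 2 / h)) (by linarith)
      have h2 := Real.exp_nonneg (2 * b / h * (2 * ((v ++ l).count true : ℕ) -
        ((u ++ (v ++ l)).count true : ℕ) - (l.count true : ℕ)) + -(2 * b ^ 2 / h))
      linarith
  · positivity

/-- The false alarm probability of a single test. -/
theorem sampleMean_alarm_nil_le {p : ℝ} (hp : p ∈ Set.Icc (0 : ℝ) 1) {h : ℕ} (hh : 0 < h) {b : ℝ}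
    (hb : 0 ≤ b) (n : ℕ) : sampleMean p n [] (alarmIndicator (2 * h) b) ≤ 2 * Real.exp (-(b ^ 2 / h)) := by
  by_cases hn : 2 * h ≤ n
  · obtain ⟨k, rfl⟩ := Nat.exists_eq_add_of_le hn
    -- The test sees only the last `2h` outcomes, so the bound is uniform in the first `k`.
    rw [show 2 * h + k = k + (h + h) by ring, sampleMean_add]
    refine sampleMean_le_of_le hp _ _ fun v _ => ?_
    rw [sampleMean_add]
    exact sampleMean_alarm_le hp hh hb _
  · refine sampleMean_le_of_le hp _ _ fun v hv => ?_
    unfold alarmIndicator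
    rw [if_neg]
    · positivity
    · rintro ⟨hlen, -⟩
      simp [hv] at hlen
      omega

/-- The probability that a test misses a change from `p` to `q`. -/
theorem sampleMean_not_alarm_le {p q : ℝ} (hp : p ∈ Set.Icc (0 : ℝ) 1)
    (hq : q ∈ Set.Icc (0 : ℝ) 1) {h n : ℕ} (hn : h ≤ n) {b c : ℝ} (hc : 0 ≤ c)
    (hpq : b + c * h ≤ h * |p - q|) :
    sampleMean p n [] (fun l => sampleMean q h l fun l' => 1 - alarmIndicator (2 * h) b l') ≤
      Real.exp (-(h * c ^ 2)) := by
  obtain ⟨k, rfl⟩ := Nat.exists_eq_add_of_le hn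
  rw [add_comm h k, sampleMean_add]
  refine sampleMean_le_of_le hp _ _ fun v _ => ?_
  generalize v ++ [] = l
  have main : ∀ σ : ℝ, |σ| = 1 → σ * (p - q) = |p - q| →
      sampleMean p h l (fun l => sampleMean q h l fun l' => 1 - alarmIndicator (2 * h) b l') ≤
      Real.exp (-(h * c ^ 2)) := by
    intro σ hσ hσpq
    have hσ2 : σ ^ 2 = 1 := by rw [← sq_abs, hσ, one_pow]
    -- Here `σ` is the sign of the change. Without an alarm the signed difference is at most `b`,
    -- while its mean exceeds `b` by at least `c h`; `2c` is the optimal exponent for this margin.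
    have k1 := sampleMean_exp_count_sub_le hp hq (-(2 * c * σ)) (2 * c * b) h l
    refine le_trans ?_ (k1.trans (Real.exp_le_exp.2 ?_))
    · refine sampleMean_mono hp _ _ fun v hv => ?_
      refine sampleMean_mono hq _ _ fun u hu => ?_
      unfold alarmIndicator
      split_ifs with ha
      · rw [sub_self]; positivity
      · rw [mdbAlarm_append_iff hu hv, not_lt] at ha
        rw [sub_zero]
        apply Real.one_le_exp
        set x : ℝ := 2 * ((v ++ l).count true : ℕ) - ((u ++ (v ++ l)).count true : ℕ) -
          (l.count true : ℕ)
        have h1 : σ * x ≤ b := by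
          calc σ * x ≤ |σ * x| := le_abs_self _
            _ = |x| := by rw [abs_mul, hσ, one_mul]
            _ ≤ b := ha
        nlinarith [mul_le_mul_of_nonneg_left h1 hc]
    · have e : (h : ℝ) * -(2 * c * σ) * (p - q) + h * (-(2 * c * σ)) ^ 2 / 4 + 2 * c * b =
          -(2 * c * (h * |p - q|)) + h * c ^ 2 + 2 * c * b := by
        rw [← hσpq]
        linear_combination h * c ^ 2 * hσ2
      rw [e]
      nlinarith [mul_le_mul_of_nonneg_left hpq hc]
  rcases le_total 0 (p - q) with h0 | h0
  · exact main 1 (by simp) (by rw [abs_of_nonneg h0, one_mul])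
  · exact main (-1) (by simp) (by rw [abs_of_nonpos h0]; ring)

/-! ### Counting detection steps in cycles. -/

/-- The number of `j` with `x ≤ j < y` that are congruent to `r` modulo `cyc`. -/
def visits (cyc r x y : ℕ) : ℕ := ((Finset.Ico x y).filter fun j => j % cyc = r).card

/-- The number of `j` with `x ≤ j < y` whose residue modulo `cyc` is less than `k`. -/
def exploreSteps (cyc k x y : ℕ) : ℕ := ((Finset.Ico x y).filter fun j => j % cyc < k).card

theorem card_filter_Ico_eq_add {x y : ℕ} (h : x < y) (P : ℕ → Prop) [DecidablePred P] :
    ((Finset.Ico x y).filter P).card =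
      (if P x then 1 else 0) + ((Finset.Ico (x + 1) y).filter P).card := by
  rw [← Finset.insert_Ico_add_one_left_eq_Ico h, Finset.filter_insert]
  split_ifs
  · rw [Finset.card_insert_of_notMem (by simp), add_comm]
  · rw [zero_add]

theorem card_filter_Ico_add_mul_of_periodic (P : ℕ → Prop) [DecidablePred P] (cyc : ℕ)
    (hP : Function.Periodic P cyc) (x n : ℕ) :
    ((Finset.Ico x (x + n * cyc)).filter P).card = n * cyc.count P := by
  induction n with
  | zero => simp
  | succ n ih =>
    rw [← Finset.Ico_union_Ico_eq_Ico (b := x + n * cyc) (by omega)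
      (by rw [add_one_mul]; omega), Finset.filter_union, Finset.card_union_of_disjoint, ih,
      add_one_mul, add_one_mul, ← add_assoc, Nat.filter_Ico_card_eq_of_periodic _ _ _ hP]
    exact Finset.disjoint_filter_filter (Finset.Ico_disjoint_Ico_consecutive _ _ _)

theorem visits_add_mul {cyc r : ℕ} (hr : r < cyc) (x n : ℕ) :
    visits cyc r x (x + n * cyc) = n := by
  rw [visits, card_filter_Ico_add_mul_of_periodic _ cyc (fun j => by simp),
    Nat.count_eq_card_filter_range]
  have : (Finset.range cyc).filter (fun j => j % cyc = r) = {r} := by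
    ext j
    simp only [Finset.mem_filter, Finset.mem_range, Finset.mem_singleton]
    constructor
    · rintro ⟨h1, h2⟩
      rwa [Nat.mod_eq_of_lt h1] at h2
    · rintro rfl
      exact ⟨hr, Nat.mod_eq_of_lt hr⟩
  simp [this]

theorem visits_mono {cyc r x y z : ℕ} (h : y ≤ z) : visits cyc r x y ≤ visits cyc r x z :=
  Finset.card_le_card (Finset.filter_subset_filter _ (Finset.Ico_subset_Ico_right h))

theorem exploreSteps_le {cyc : ℕ} (hc : 0 < cyc) (k n : ℕ) :
    exploreSteps cyc k 0 n ≤ (n / cyc + 1) * k := by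
  -- The interval is enlarged to whole cycles, each of which has at most `k` detection steps.
  have h1 : n ≤ 0 + (n / cyc + 1) * cyc := by
    have := Nat.lt_div_mul_add hc (a := n)
    rw [add_one_mul]
    omega
  calc exploreSteps cyc k 0 n
      ≤ exploreSteps cyc k 0 (0 + (n / cyc + 1) * cyc) :=
        Finset.card_le_card (Finset.filter_subset_filter _ (Finset.Ico_subset_Ico_right h1))
    _ = (n / cyc + 1) * cyc.count fun j => j % cyc < k :=
        card_filter_Ico_add_mul_of_periodic _ cyc (fun j => by simp) _ _
    _ ≤ _ := by
        refine Nat.mul_le_mul_left _ ?_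
        rw [Nat.count_eq_card_filter_range]
        refine (Finset.card_le_card (t := Finset.range k) fun j hj => ?_).trans_eq (by simp)
        simp only [Finset.mem_filter, Finset.mem_range] at hj ⊢
        rw [Nat.mod_eq_of_lt hj.1] at hj
        exact hj.2

/-- Averaging over the outcome of the detection step of the pair `a` at time `x`. -/
theorem sampleMean_observe {K cyc : ℕ} (O : Fin (K * (K - 1) / 2) ≃ ArmPair K)
    (p : ArmPair K → ℝ) (obs : ArmPair K → List Bool) {a : ArmPair K} {x y : ℕ}
    (ha : x % cyc = O.symm a) (hxy : x < y) (a' : ArmPair K) (G : List Bool → ℝ) :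
    p a * sampleMean (p a') (visits cyc (O.symm a') (x + 1) y)
        (Function.update obs a (true :: obs a) a') G +
      (1 - p a) * sampleMean (p a') (visits cyc (O.symm a') (x + 1) y)
        (Function.update obs a (false :: obs a) a') G =
      sampleMean (p a') (visits cyc (O.symm a') x y) (obs a') G := by
  have h : visits cyc (O.symm a') x y =
      (if x % cyc = O.symm a' then 1 else 0) + visits cyc (O.symm a') (x + 1) y :=
    card_filter_Ico_eq_add hxy _
  by_cases haa : a' = a
  · subst haa
    rw [h, if_pos ha, add_comm 1, sampleMean, Function.update_self, Function.update_self]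
  · rw [h, if_neg, Function.update_of_ne haa, Function.update_of_ne haa, zero_add]
    · ring
    · rw [ha]
      intro h'
      exact haa (O.symm.injective (Fin.ext h')).symm

theorem visits_eq_of_ne {cyc r x y : ℕ} (hxy : x < y) (h : x % cyc ≠ r) :
    visits cyc r x y = visits cyc r (x + 1) y := by
  have := card_filter_Ico_eq_add hxy (fun j => j % cyc = r)
  rwa [if_neg h, zero_add] at this

/-! ### Alarm probabilities after a restart. -/

/-- The probability of an alarm `u + 1` time steps after a restart of MDB, given the observations
`obs` of the first `x` of them, provided that there is no earlier alarm. -/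
noncomputable def alarmProb {K : ℕ} (O : Fin (K * (K - 1) / 2) ≃ ArmPair K) (cyc w : ℕ) (b : ℝ)
    (p : ArmPair K → ℝ) (obs : ArmPair K → List Bool) (x u : ℕ) : ℝ :=
  if h : u % cyc < K * (K - 1) / 2 then
    sampleMean (p (O ⟨u % cyc, h⟩)) (visits cyc (O.symm (O ⟨u % cyc, h⟩)) x (u + 1))
      (obs (O ⟨u % cyc, h⟩)) (alarmIndicator w b)
  else 0

section alarmProb

variable {K : ℕ} (O : Fin (K * (K - 1) / 2) ≃ ArmPair K) (cyc w : ℕ) (b : ℝ)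
  {p : ArmPair K → ℝ}

theorem alarmProb_nonneg (hp : ∀ a, p a ∈ Set.Icc (0 : ℝ) 1) (obs : ArmPair K → List Bool)
    (x u : ℕ) : 0 ≤ alarmProb O cyc w b p obs x u := by
  unfold alarmProb
  split_ifs
  · exact sampleMean_nonneg (hp _) (alarmIndicator_nonneg w b) _ _
  · exact le_rfl

theorem sum_alarmProb_nonneg (hp : ∀ a, p a ∈ Set.Icc (0 : ℝ) 1) (obs : ArmPair K → List Bool)
    (x y z : ℕ) : 0 ≤ ∑ u ∈ Finset.Ico y z, alarmProb O cyc w b p obs x u :=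
  Finset.sum_nonneg fun _ _ => alarmProb_nonneg O cyc w b hp _ _ _

/-- Martingale property in the idealized process that never restarts. Ignoring earlier alarms in
this way is what makes the later sum over `u` a union bound. -/
theorem alarmProb_observe (obs : ArmPair K → List Bool) {a : ArmPair K} {x u : ℕ}
    (ha : x % cyc = O.symm a) (hxu : x ≤ u) :
    p a * alarmProb O cyc w b p (Function.update obs a (true :: obs a)) (x + 1) u +
      (1 - p a) * alarmProb O cyc w b p (Function.update obs a (false :: obs a)) (x + 1) u =
      alarmProb O cyc w b p obs x u := by
  unfold alarmProb
  split_ifs with h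
  · exact sampleMean_observe O p obs ha (Nat.lt_succ_of_le hxu) _ _
  · simp

theorem alarmProb_self (obs : ArmPair K → List Bool) {a : ArmPair K} {x : ℕ}
    (ha : x % cyc = O.symm a) :
    p a * alarmIndicator w b (true :: obs a) + (1 - p a) * alarmIndicator w b (false :: obs a) =
      alarmProb O cyc w b p obs x x := by
  have hlt : x % cyc < K * (K - 1) / 2 := ha ▸ (O.symm a).2
  have hO : O ⟨x % cyc, hlt⟩ = a := by
    rw [← O.apply_symm_apply a]
    congr 1
    exact Fin.ext ha
  have hv : visits cyc (O.symm a) x (x + 1) = 1 := by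
    have := card_filter_Ico_eq_add (Nat.lt_succ_self x) (fun j => j % cyc = O.symm a)
    rw [if_pos ha] at this
    simpa [visits] using this
  rw [alarmProb, dif_pos hlt, hO, hv]
  rfl

theorem alarmProb_eq_of_not_lt (obs : ArmPair K → List Bool) {x u : ℕ}
    (hx : ¬ x % cyc < K * (K - 1) / 2) (hxu : x ≤ u) :
    alarmProb O cyc w b p obs x u = alarmProb O cyc w b p obs (x + 1) u := by
  unfold alarmProb
  split_ifs with h
  · rw [visits_eq_of_ne (Nat.lt_succ_of_le hxu)]
    intro h'
    exact hx (h' ▸ (O.symm _).2)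
  · rfl

end alarmProb

/-! ### Regret within one segment. -/

namespace DuelingEnv

variable {K T N : ℕ} (E : DuelingEnv K T N)
variable (O : Fin (K * (K - 1) / 2) ≃ ArmPair K) (w : ℕ) (b γ : ℝ) (alg : DuelingAlg K)

/-- The probability that the first arm of a pair wins in segment `m`. -/
def winProb (m : Fin (N + 1)) (a : ArmPair K) : ℝ := E.P m a.1.1 a.1.2

theorem winProb_mem (m : Fin (N + 1)) (a : ArmPair K) : E.winProb m a ∈ Set.Icc (0 : ℝ) 1 :=
  E.P_mem _ _ _

/-- A detection step costs at most one unit of regret, and its outcome either raises an alarm or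
is recorded. -/
theorem mdbValue_succ_le_of_detection (n t : ℕ) (s : MDBState K) (a : ArmPair K)
    (ha : (t - s.τ) % mdbCycle K γ = O.symm a) (B : Bool → ℝ)
    (hB : ∀ y, (mdbAlarm w b (y :: s.obs a) →
        E.mdbValue O w b γ alg n (t + 1) (MDBState.fresh K (t + 1)) ≤ B y) ∧
      (¬ mdbAlarm w b (y :: s.obs a) → E.mdbValue O w b γ alg n (t + 1)
        { s with obs := Function.update s.obs a (y :: s.obs a) } ≤ B y)) :
    E.mdbValue O w b γ alg (n + 1) t s ≤
      1 + (E.winProb (E.segment (t + 1)) a * B true +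
        (1 - E.winProb (E.segment (t + 1)) a) * B false) := by
  have hlt : (t - s.τ) % mdbCycle K γ < K * (K - 1) / 2 := ha ▸ (O.symm a).2
  have hO : a = O ⟨(t - s.τ) % mdbCycle K γ, hlt⟩ := by
    rw [← O.apply_symm_apply a]
    congr 1
    exact Fin.ext (by simp [ha])
  rw [E.mdbValue_succ_of_lt O w b γ alg n t s hlt a hO]
  refine add_le_add (E.binaryStrongRegret_le_one _ _)
    (average_mono (E.P_mem _ _ _) ?_ ?_)
  · split_ifs with h
    · exact (hB true).1 h
    · exact (hB true).2 h
  · split_ifs with h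
    · exact (hB false).1 h
    · exact (hB false).2 h

theorem not_mdbAlarm_update {s : MDBState K} (hs : ∀ a, ¬ mdbAlarm w b (s.obs a))
    {a : ArmPair K} {l : List Bool} (hl : ¬ mdbAlarm w b l) (a' : ArmPair K) :
    ¬ mdbAlarm w b (Function.update s.obs a l a') := by
  by_cases h : a' = a
  · subst h
    rwa [Function.update_self]
  · rw [Function.update_of_ne h]
    exact hs a'

/-- The regret of MDB after a restart in segment `m`, which ends at time `e`. -/
theorem mdbValue_le_of_fresh (m : Fin (N + 1)) {e : ℕ} (he : e ≤ T) (c : ArmPair K)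
    {G : List Bool → ℝ} (hG : ∀ l, 0 ≤ G l) {H : ℝ} (hH : 0 ≤ H)
    (hend : ∀ s : MDBState K, s.τ ≤ e → (∀ a, ¬ mdbAlarm w b (s.obs a)) →
      E.mdbValue O w b γ alg (T - e) e s ≤ G (s.obs c) + H) (n : ℕ) :
    ∀ (x : ℕ) (s : MDBState K), s.τ + x + n = e →
      (∀ t, s.τ + x < t → t ≤ e → E.segment t = m) → (∀ a, ¬ mdbAlarm w b (s.obs a)) →
      E.mdbValue O w b γ alg (T - (s.τ + x)) (s.τ + x) s ≤
        E.algValue alg m n s.hist +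
        exploreSteps (mdbCycle K γ) (K * (K - 1) / 2) x (x + n) +
        T * ∑ u ∈ Finset.Ico x (x + n),
          alarmProb O (mdbCycle K γ) w b (E.winProb m) s.obs x u +
        sampleMean (E.winProb m c) (visits (mdbCycle K γ) (O.symm c) x (x + n)) (s.obs c) G +
        H := by
  induction n with
  | zero =>
    intro x s hx _ hs
    have h := hend s (by omega) hs
    have hx' : s.τ + x = e := hx
    simpa [hx', algValue, exploreSteps, visits, sampleMean] using h
  | succ n ih =>
    intro x s hx hm hs
    have hseg : E.segment (s.τ + x + 1) = m := hm _ (by omega) (by omega)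
    have hT : T - (s.τ + x) = (T - (s.τ + x + 1)) + 1 := by omega
    have hxn : x + (n + 1) = x + 1 + n := by ring
    rw [hT, hxn]
    have hlt : x < x + 1 + n := by omega
    have hsum : ∑ u ∈ Finset.Ico x (x + 1 + n),
        alarmProb O (mdbCycle K γ) w b (E.winProb m) s.obs x u =
        alarmProb O (mdbCycle K γ) w b (E.winProb m) s.obs x x +
        ∑ u ∈ Finset.Ico (x + 1) (x + 1 + n),
          alarmProb O (mdbCycle K γ) w b (E.winProb m) s.obs x u :=
      Finset.sum_eq_sum_Ico_succ_bot hlt _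
    have hexp := card_filter_Ico_eq_add hlt
      (fun j => j % mdbCycle K γ < K * (K - 1) / 2)
    by_cases hd : x % mdbCycle K γ < K * (K - 1) / 2
    · set a : ArmPair K := O ⟨x % mdbCycle K γ, hd⟩ with ha
      have ha' : x % mdbCycle K γ = O.symm a := by simp [ha]
      rw [if_pos hd] at hexp
      set Z : Bool → ℝ := fun y => ∑ u ∈ Finset.Ico (x + 1) (x + 1 + n),
        alarmProb O (mdbCycle K γ) w b (E.winProb m)
          (Function.update s.obs a (y :: s.obs a)) (x + 1) u with hZ
      set D : Bool → ℝ := fun y => sampleMean (E.winProb m c)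
        (visits (mdbCycle K γ) (O.symm c) (x + 1) (x + 1 + n))
        (Function.update s.obs a (y :: s.obs a) c) G with hD
      set R : ℝ := E.algValue alg m (n + 1) s.hist +
        exploreSteps (mdbCycle K γ) (K * (K - 1) / 2) (x + 1) (x + 1 + n) + H with hR
      have hR0 : 0 ≤ R := by
        have := E.algValue_nonneg alg m (n + 1) s.hist
        positivity
      have hstep := E.mdbValue_succ_le_of_detection O w b γ alg (T - (s.τ + x + 1)) (s.τ + x) s a
        (by simpa using ha')
        (fun y => R + T * (alarmIndicator w b (y :: s.obs a) + Z y) + D y)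
        (fun y => ⟨fun hal => ?_, fun hal => ?_⟩)
      · refine hstep.trans (le_of_eq ?_)
        rw [hseg]
        have e1 : E.winProb m a * alarmIndicator w b (true :: s.obs a) +
            (1 - E.winProb m a) * alarmIndicator w b (false :: s.obs a) =
            alarmProb O (mdbCycle K γ) w b (E.winProb m) s.obs x x :=
          alarmProb_self O _ w b s.obs ha'
        have e2 : E.winProb m a * Z true + (1 - E.winProb m a) * Z false =
            ∑ u ∈ Finset.Ico (x + 1) (x + 1 + n),
              alarmProb O (mdbCycle K γ) w b (E.winProb m) s.obs x u := by
          simp only [hZ]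
          rw [Finset.mul_sum, Finset.mul_sum, ← Finset.sum_add_distrib]
          refine Finset.sum_congr rfl fun u hu => ?_
          rw [Finset.mem_Ico] at hu
          exact alarmProb_observe O _ w b s.obs ha' (by omega)
        have e3 : E.winProb m a * D true + (1 - E.winProb m a) * D false =
            sampleMean (E.winProb m c) (visits (mdbCycle K γ) (O.symm c) x (x + 1 + n))
              (s.obs c) G :=
          sampleMean_observe O (E.winProb m) s.obs ha' hlt c G
        have e4 : (exploreSteps (mdbCycle K γ) (K * (K - 1) / 2) x (x + 1 + n) : ℝ) =
            1 + exploreSteps (mdbCycle K γ) (K * (K - 1) / 2) (x + 1) (x + 1 + n) := by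
          exact_mod_cast hexp
        rw [hsum, ← e1, ← e2, ← e3, e4, hR]
        ring
      -- False alarm: the remaining regret is at most `T`, which the term `T * alarmIndicator` pays.
      · have h1 := E.mdbValue_le O w b γ alg (T - (s.τ + x + 1)) (s.τ + x + 1)
          (MDBState.fresh K (s.τ + x + 1))
        have h2 : ((T - (s.τ + x + 1) : ℕ) : ℝ) ≤ T := by exact_mod_cast Nat.sub_le _ _
        have h3 : alarmIndicator w b (y :: s.obs a) = 1 := if_pos hal
        have h4 : 0 ≤ Z y := sum_alarmProb_nonneg O _ w b (E.winProb_mem m) _ _ _ _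
        have h5 : 0 ≤ D y := sampleMean_nonneg (E.winProb_mem m c) hG _ _
        have h6 : (0 : ℝ) ≤ T * Z y := by positivity
        rw [h3]
        linarith
      · have h1 := ih (x + 1) { s with obs := Function.update s.obs a (y :: s.obs a) }
          (by simp only; omega) (fun t ht => hm t (by simp only at ht; omega))
          (not_mdbAlarm_update w b hs hal)
        simp only [← add_assoc] at h1
        refine h1.trans ?_
        -- The black box was idle in this step, so one of its steps is given away.
        have h2 := E.algValue_le_succ alg m n s.hist
        have h3 : (0 : ℝ) ≤ T * alarmIndicator w b (y :: s.obs a) :=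
          mul_nonneg (Nat.cast_nonneg _) (alarmIndicator_nonneg _ _ _)
        simp only [hR, hZ, hD, mul_add]
        linarith
    · rw [if_neg hd, zero_add] at hexp
      have hv : visits (mdbCycle K γ) (O.symm c) x (x + 1 + n) =
          visits (mdbCycle K γ) (O.symm c) (x + 1) (x + 1 + n) :=
        visits_eq_of_ne hlt fun h => hd (h ▸ (O.symm c).2)
      have hself : alarmProb O (mdbCycle K γ) w b (E.winProb m) s.obs x x = 0 := dif_neg hd
      have hal : ∑ u ∈ Finset.Ico (x + 1) (x + 1 + n),
          alarmProb O (mdbCycle K γ) w b (E.winProb m) s.obs x u =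
          ∑ u ∈ Finset.Ico (x + 1) (x + 1 + n),
          alarmProb O (mdbCycle K γ) w b (E.winProb m) s.obs (x + 1) u :=
        Finset.sum_congr rfl fun u hu => by
          rw [Finset.mem_Ico] at hu
          exact alarmProb_eq_of_not_lt O _ w b s.obs hd (by omega)
      have hexp' : exploreSteps (mdbCycle K γ) (K * (K - 1) / 2) x (x + 1 + n) =
          exploreSteps (mdbCycle K γ) (K * (K - 1) / 2) (x + 1) (x + 1 + n) := hexp
      rw [E.mdbValue_succ_of_not_lt O w b γ alg _ _ s (by simpa using hd), hsum, hself, hal,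
        zero_add, hv, hexp', hseg]
      set R : ℝ := exploreSteps (mdbCycle K γ) (K * (K - 1) / 2) (x + 1) (x + 1 + n) +
        T * ∑ u ∈ Finset.Ico (x + 1) (x + 1 + n),
          alarmProb O (mdbCycle K γ) w b (E.winProb m) s.obs (x + 1) u +
        sampleMean (E.winProb m c) (visits (mdbCycle K γ) (O.symm c) (x + 1) (x + 1 + n))
          (s.obs c) G + H with hR
      have hih : ∀ l, E.mdbValue O w b γ alg (T - (s.τ + x + 1)) (s.τ + x + 1)
          { s with hist := l } ≤ R + E.algValue alg m n l := by
        intro l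
        have h1 := ih (x + 1) { s with hist := l }
          (by simp only; omega) (fun t ht => hm t (by simp only at ht; omega)) hs
        simp only [← add_assoc] at h1
        rw [hR]
        linarith
      -- On a step of the black box only `hist` changes. Since `R` does not depend on it, the
      -- recursion of `algValue` is reproduced exactly.
      calc _ ≤ expectation (alg s.hist) fun a => R + (E.binaryStrongRegret m a +
            (E.P m a.1 a.2 * E.algValue alg m n ((a, true) :: s.hist) +
              (1 - E.P m a.1 a.2) * E.algValue alg m n ((a, false) :: s.hist))) := by
            refine expectation_mono _ _ _ (Set.toFinite _) fun a => ?_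
            have := average_mono (E.P_mem m a.1 a.2) (hih ((a, true) :: s.hist))
              (hih ((a, false) :: s.hist))
            linarith
        _ = R + E.algValue alg m (n + 1) s.hist := expectation_const_add _ _ _ (Set.toFinite _)
        _ = _ := by rw [hR]; ring

/-- The regret of MDB in segment `m` when it was last restarted in an earlier segment, up to the
time `d` by which the change of the pair `c` should be detected. -/
theorem mdbValue_le_of_stale (m : Fin (N + 1)) {e d : ℕ} (hd : d ≤ T) (c : ArmPair K)
    {H : ℝ} (hH : 0 ≤ H)
    (hfresh : ∀ t, e ≤ t → t ≤ d →
      E.mdbValue O w b γ alg (T - t) t (MDBState.fresh K t) ≤ H) (n : ℕ) :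
    ∀ (x : ℕ) (s : MDBState K), s.τ + x + n = d → e ≤ s.τ + x →
      (∀ t, s.τ + x < t → t ≤ d → E.segment t = m) → (∀ a, ¬ mdbAlarm w b (s.obs a)) →
      E.mdbValue O w b γ alg (T - (s.τ + x)) (s.τ + x) s ≤
        n + H + sampleMean (E.winProb m c)
          (visits (mdbCycle K γ) (O.symm c) x (x + n)) (s.obs c)
          fun l => T * (1 - alarmIndicator w b l) := by
  have hG : ∀ l, (0 : ℝ) ≤ T * (1 - alarmIndicator w b l) := fun l =>
    mul_nonneg (Nat.cast_nonneg _) (sub_nonneg.2 (alarmIndicator_le_one w b l))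
  induction n with
  | zero =>
    intro x s hx _ _ hs
    have h1 := E.mdbValue_le O w b γ alg (T - (s.τ + x)) (s.τ + x) s
    have h2 : ((T - (s.τ + x) : ℕ) : ℝ) ≤ T := by exact_mod_cast Nat.sub_le _ _
    -- A run that reaches time `d` without a restart has no alarm in its records, so the change was
    -- missed and the integrand is `T`.
    have h3 : alarmIndicator w b (s.obs c) = 0 := if_neg (hs c)
    simp only [visits, add_zero, Finset.Ico_self, Finset.filter_empty, Finset.card_empty,
      sampleMean, h3]
    push_cast
    linarith
  | succ n ih =>
    intro x s hx hex hm hs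
    have hseg : E.segment (s.τ + x + 1) = m := hm _ (by omega) (by omega)
    have hT : T - (s.τ + x) = (T - (s.τ + x + 1)) + 1 := by omega
    have hxn : x + (n + 1) = x + 1 + n := by ring
    rw [hT, hxn]
    have hlt : x < x + 1 + n := by omega
    push_cast
    by_cases hd : x % mdbCycle K γ < K * (K - 1) / 2
    · set a : ArmPair K := O ⟨x % mdbCycle K γ, hd⟩ with ha
      have ha' : x % mdbCycle K γ = O.symm a := by simp [ha]
      set D : Bool → ℝ := fun y => sampleMean (E.winProb m c)
        (visits (mdbCycle K γ) (O.symm c) (x + 1) (x + 1 + n))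
        (Function.update s.obs a (y :: s.obs a) c)
        fun l => T * (1 - alarmIndicator w b l) with hD
      have hstep := E.mdbValue_succ_le_of_detection O w b γ alg (T - (s.τ + x + 1)) (s.τ + x) s a
        (by simpa using ha') (fun y => n + H + D y) (fun y => ⟨fun hal => ?_, fun hal => ?_⟩)
      · refine hstep.trans (le_of_eq ?_)
        rw [hseg, ← sampleMean_observe O (E.winProb m) s.obs ha' hlt c]
        ring
      · have h1 := hfresh (s.τ + x + 1) (by omega) (by omega)
        have h5 : 0 ≤ D y := sampleMean_nonneg (E.winProb_mem m c) hG _ _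
        have h6 : (0 : ℝ) ≤ n := Nat.cast_nonneg _
        linarith
      · have h1 := ih (x + 1) { s with obs := Function.update s.obs a (y :: s.obs a) }
          (by simp only; omega) (by simp only; omega)
          (fun t ht => hm t (by simp only at ht; omega)) (not_mdbAlarm_update w b hs hal)
        simpa only [← add_assoc] using h1
    · have hv : visits (mdbCycle K γ) (O.symm c) x (x + 1 + n) =
          visits (mdbCycle K γ) (O.symm c) (x + 1) (x + 1 + n) :=
        visits_eq_of_ne hlt fun h => hd (h ▸ (O.symm c).2)
      rw [E.mdbValue_succ_of_not_lt O w b γ alg _ _ s (by simpa using hd), hv]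
      set R : ℝ := n + H + sampleMean (E.winProb m c)
        (visits (mdbCycle K γ) (O.symm c) (x + 1) (x + 1 + n)) (s.obs c)
        fun l => T * (1 - alarmIndicator w b l) with hR
      have hih : ∀ l, E.mdbValue O w b γ alg (T - (s.τ + x + 1)) (s.τ + x + 1)
          { s with hist := l } ≤ R := by
        intro l
        have h1 := ih (x + 1) { s with hist := l }
          (by simp only; omega) (by simp only; omega)
          (fun t ht => hm t (by simp only at ht; omega)) hs
        simpa only [← add_assoc] using h1
      calc _ ≤ expectation (alg s.hist) fun _ => 1 + R := by
            refine expectation_mono _ _ _ (Set.toFinite _) fun a => ?_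
            have h1 := average_mono (E.P_mem (E.segment (s.τ + x + 1)) a.1 a.2)
              (hih ((a, true) :: s.hist)) (hih ((a, false) :: s.hist))
            have h2 := E.binaryStrongRegret_le_one (E.segment (s.τ + x + 1)) a
            linarith
        _ = 1 + R := expectation_const _ _ (Set.toFinite _)
        _ = _ := by rw [hR]; ring

end DuelingEnv

/-! ### Segments as time intervals. -/

namespace DuelingEnv

variable {K T N : ℕ} (E : DuelingEnv K T N)

theorem segment_mono : Monotone E.segment := fun t u h =>
  Fin.mk_le_mk.2 (Finset.card_le_card fun k hk => by
    simp only [Finset.mem_filter, Finset.mem_univ, true_and] at hk ⊢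
    exact hk.trans h)

/-- The last time step before segment `j`. -/
def segmentEnd (j : ℕ) : ℕ := ((Finset.Icc 1 T).filter fun t => (E.segment t : ℕ) < j).card

theorem le_segmentEnd_iff {t : ℕ} (h1 : 1 ≤ t) (hT : t ≤ T) (j : ℕ) :
    t ≤ E.segmentEnd j ↔ (E.segment t : ℕ) < j := by
  constructor
  · intro h
    by_contra hj
    have hsub : ((Finset.Icc 1 T).filter fun t => (E.segment t : ℕ) < j) ⊆
        Finset.Icc 1 (t - 1) := by
      intro u hu
      simp only [Finset.mem_filter, Finset.mem_Icc] at hu ⊢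
      refine ⟨hu.1.1, ?_⟩
      by_contra hut
      have : (E.segment t : ℕ) ≤ E.segment u := E.segment_mono (by omega)
      omega
    have := Finset.card_le_card hsub
    rw [Nat.card_Icc] at this
    unfold segmentEnd at h
    omega
  · intro h
    have hsub : Finset.Icc 1 t ⊆ ((Finset.Icc 1 T).filter fun t => (E.segment t : ℕ) < j) := by
      intro u hu
      simp only [Finset.mem_filter, Finset.mem_Icc] at hu ⊢
      have : (E.segment u : ℕ) ≤ E.segment t := E.segment_mono hu.2
      omega
    have := Finset.card_le_card hsub
    rw [Nat.card_Icc] at this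
    unfold segmentEnd
    omega

theorem segmentEnd_le (j : ℕ) : E.segmentEnd j ≤ T :=
  (Finset.card_le_card (Finset.filter_subset _ _)).trans_eq (by simp)

theorem segmentEnd_zero : E.segmentEnd 0 = 0 := by simp [segmentEnd]

theorem segmentEnd_last : E.segmentEnd (N + 1) = T := by
  rw [segmentEnd, Finset.filter_true_of_mem fun t _ => (E.segment t).2, Nat.card_Icc]
  rfl

theorem segmentEnd_succ (m : Fin (N + 1)) :
    E.segmentEnd (m + 1) = E.segmentEnd m + E.segmentLength m := by
  unfold segmentEnd segmentLength
  rw [← Finset.card_union_of_disjoint, ← Finset.filter_or]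
  · congr 1
    ext t
    simp only [Finset.mem_filter, Fin.ext_iff, Nat.lt_succ_iff_lt_or_eq]
  · refine Finset.disjoint_filter.2 fun t _ h1 h2 => ?_
    rw [h2] at h1
    exact lt_irrefl _ h1

theorem segment_eq {m : Fin (N + 1)} {t : ℕ} (h1 : E.segmentEnd m < t)
    (h2 : t ≤ E.segmentEnd (m + 1)) : E.segment t = m := by
  have hT := h2.trans (E.segmentEnd_le _)
  have h3 := (E.le_segmentEnd_iff (by omega) hT _).1 h2
  have h4 := mt (E.le_segmentEnd_iff (by omega) hT _).2 (not_le.2 h1)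
  exact Fin.ext (by omega)

theorem sum_segmentLength : ∑ m, E.segmentLength m = T := by
  have h : ∀ j, ∀ hj : j ≤ N + 1, ∑ i : Fin j, E.segmentLength (Fin.castLE hj i) =
      E.segmentEnd j := by
    intro j
    induction j with
    | zero => simp [segmentEnd_zero]
    | succ j ih =>
      intro hj
      rw [Fin.sum_univ_castSucc]
      have := ih (by omega)
      have h2 := E.segmentEnd_succ ⟨j, hj⟩
      simp only at h2
      rw [h2, ← this]
      rfl
  exact (h _ le_rfl).trans E.segmentEnd_last

/-! ### Summation over the segments. -/

section MDB

variable (O : Fin (K * (K - 1) / 2) ≃ ArmPair K) (h : ℕ) (b γ q : ℝ) (alg : DuelingAlg K)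

/-- The contribution of segment `m` to the bound on the regret of MDB, apart from the delay until
the detection of its beginning. -/
noncomputable def segmentCost (m : Fin (N + 1)) : ℝ :=
  E.algValue alg m (E.segmentLength m) [] +
    (E.segmentLength m / mdbCycle K γ + 1) * (K * (K - 1) / 2 : ℕ) +
    T * (E.segmentLength m * (2 * q) + q)

variable {h b γ q}

theorem segmentCost_nonneg (hq : 0 ≤ q) (m : Fin (N + 1)) :
    0 ≤ E.segmentCost γ q alg m := by
  have := E.algValue_nonneg alg m (E.segmentLength m) []
  unfold segmentCost
  positivity

theorem not_mdbAlarm_nil (hh : 0 < h) : ¬ mdbAlarm (2 * h) b [] := by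
  rintro ⟨hl, -⟩
  simp at hl
  omega

/-- A restart within the first `h` cycles leaves at least `3h` cycles of the segment, so each pair
collects at least `h` outcomes before it ends. `G` is the expected charge for missing the next
change, given the records of `c`; `H` is all other later cost. -/
theorem mdbValue_fresh_le_segmentCost (hh : 0 < h) (hb : 0 ≤ b)
    (hcyc : K * (K - 1) / 2 ≤ mdbCycle K γ) (hcyc0 : 0 < mdbCycle K γ)
    (hq : Real.exp (-(b ^ 2 / h)) ≤ q)
    (hlen : ∀ m, 2 * (2 * h * mdbCycle K γ) ≤ E.segmentLength m)
    (m : Fin (N + 1)) (c : ArmPair K) {G : List Bool → ℝ} (hG : ∀ l, 0 ≤ G l)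
    {H : ℝ} (hH : 0 ≤ H)
    (hGq : ∀ n, h ≤ n → sampleMean (E.winProb m c) n [] G ≤ T * q)
    (hend : ∀ s : MDBState K, s.τ ≤ E.segmentEnd (m + 1) →
      (∀ a, ¬ mdbAlarm (2 * h) b (s.obs a)) →
      E.mdbValue O (2 * h) b γ alg (T - E.segmentEnd (m + 1)) (E.segmentEnd (m + 1)) s ≤
        G (s.obs c) + H)
    (t : ℕ) (ht1 : E.segmentEnd m ≤ t) (ht2 : t ≤ E.segmentEnd m + h * mdbCycle K γ) :
    E.mdbValue O (2 * h) b γ alg (T - t) t (MDBState.fresh K t) ≤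
      E.segmentCost γ q alg m + H := by
  have hl := hlen m
  have hs := E.segmentEnd_succ m
  have hl' : 2 * (2 * h * mdbCycle K γ) = 4 * (h * mdbCycle K γ) := by ring
  obtain ⟨n, hn⟩ := Nat.exists_eq_add_of_le (show t ≤ E.segmentEnd (m + 1) by omega)
  have hnl : n ≤ E.segmentLength m := by omega
  have hnh : h * mdbCycle K γ ≤ n := by omega
  have main := E.mdbValue_le_of_fresh O (2 * h) b γ alg m (E.segmentEnd_le (m + 1)) c hG hH hend
    n 0 (MDBState.fresh K t) (by simp [MDBState.fresh]; omega)
    (fun u h1 h2 => E.segment_eq (by simp only [MDBState.fresh] at h1; omega) h2)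
    (fun a => not_mdbAlarm_nil hh)
  simp only [MDBState.fresh, add_zero, zero_add] at main
  have hnl' : (n : ℝ) ≤ E.segmentLength m := by exact_mod_cast hnl
  have e1 : E.algValue alg m n [] ≤ E.algValue alg m (E.segmentLength m) [] :=
    E.algValue_mono alg m [] hnl
  have e2 : (exploreSteps (mdbCycle K γ) (K * (K - 1) / 2) 0 n : ℝ) ≤
      (E.segmentLength m / mdbCycle K γ + 1) * (K * (K - 1) / 2 : ℕ) := by
    calc (exploreSteps (mdbCycle K γ) (K * (K - 1) / 2) 0 n : ℝ)
        ≤ (((n / mdbCycle K γ : ℕ) : ℝ) + 1) * (K * (K - 1) / 2 : ℕ) := by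
          exact_mod_cast exploreSteps_le hcyc0 _ _
      _ ≤ _ := by
          have h1 : ((n / mdbCycle K γ : ℕ) : ℝ) ≤ n / mdbCycle K γ := Nat.cast_div_le
          have h2 : (n : ℝ) / mdbCycle K γ ≤ E.segmentLength m / mdbCycle K γ := by gcongr
          gcongr
          exact h1.trans h2
  have hq0 : 0 ≤ q := (Real.exp_nonneg _).trans hq
  have e3 : ∑ u ∈ Finset.Ico 0 n, alarmProb O (mdbCycle K γ) (2 * h) b (E.winProb m)
      (fun _ => []) 0 u ≤ E.segmentLength m * (2 * q) := by
    calc _ ≤ ∑ u ∈ Finset.Ico 0 n, 2 * q := by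
          refine Finset.sum_le_sum fun u _ => ?_
          unfold alarmProb
          split_ifs
          · exact (sampleMean_alarm_nil_le (E.winProb_mem m _) hh hb _).trans (by linarith)
          · positivity
      _ = n * (2 * q) := by simp
      _ ≤ _ := by gcongr
  have e4 := hGq (visits (mdbCycle K γ) (O.symm c) 0 n) (by
    have h1 := visits_add_mul (lt_of_lt_of_le (O.symm c).2 hcyc) 0 h
    have h2 := visits_mono (cyc := mdbCycle K γ) (r := O.symm c) (x := 0)
      (show 0 + h * mdbCycle K γ ≤ n by omega)
    omega)
  have e5 : (T : ℝ) * ∑ u ∈ Finset.Ico 0 n, alarmProb O (mdbCycle K γ) (2 * h) b (E.winProb m)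
      (fun _ => []) 0 u ≤ T * (E.segmentLength m * (2 * q)) := by gcongr
  unfold segmentCost MDBState.fresh
  linarith

/-- Backward induction over the segments. The claim covers all restart times in the first `h` cycles
because the moment of detection is random. -/
theorem mdbValue_fresh_le_sum (hh : 0 < h) (hb : 0 ≤ b) {c δ : ℝ} (hc : 0 ≤ c)
    (hcyc : K * (K - 1) / 2 ≤ mdbCycle K γ) (hcyc0 : 0 < mdbCycle K γ)
    (hq : Real.exp (-(b ^ 2 / h)) ≤ q) (hq' : Real.exp (-(h * c ^ 2)) ≤ q)
    (hlen : ∀ m, 2 * (2 * h * mdbCycle K γ) ≤ E.segmentLength m)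
    (hδ : b + c * h ≤ h * δ) (a₀ : ArmPair K)
    (hchange : ∀ k : Fin N, ∃ a, δ ≤ |E.winProb k.castSucc a - E.winProb k.succ a|)
    (m : Fin (N + 1)) :
    ∀ t, E.segmentEnd m ≤ t → t ≤ E.segmentEnd m + h * mdbCycle K γ →
      E.mdbValue O (2 * h) b γ alg (T - t) t (MDBState.fresh K t) ≤
        ∑ i ∈ Finset.Ici m, (E.segmentCost γ q alg i + h * mdbCycle K γ) := by
  have hq0 : 0 ≤ q := (Real.exp_nonneg _).trans hq
  have hcost : ∀ m, 0 ≤ ∑ i ∈ Finset.Ici m, (E.segmentCost γ q alg i + h * mdbCycle K γ) :=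
    fun m => Finset.sum_nonneg fun i _ => add_nonneg (E.segmentCost_nonneg alg hq0 i)
      (by positivity)
  induction m using Fin.reverseInduction with
  | last =>
    intro t ht1 ht2
    have := E.mdbValue_fresh_le_segmentCost O alg hh hb hcyc hcyc0 hq hlen (Fin.last N) a₀
      (G := fun _ => 0) (fun _ => le_rfl) le_rfl
      (fun n _ => by rw [sampleMean_const]; positivity)
      (fun s _ _ => by
        rw [Fin.val_last, E.segmentEnd_last, Nat.sub_self]
        simp [mdbValue]) t ht1 ht2
    have e : Finset.Ici (Fin.last N) = {Fin.last N} := by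
      ext i; simp [Fin.last_le_iff]
    rw [e, Finset.sum_singleton]
    have : (0 : ℝ) ≤ h * mdbCycle K γ := by positivity
    linarith
  | cast k ih =>
    intro t ht1 ht2
    obtain ⟨a, ha⟩ := hchange k
    have hG : ∀ l, (0 : ℝ) ≤ T * (1 - alarmIndicator (2 * h) b l) := fun l =>
      mul_nonneg (Nat.cast_nonneg _) (sub_nonneg.2 (alarmIndicator_le_one _ b l))
    -- `G` averages over the `h` outcomes of `a` that the next segment supplies in its first `h`
    -- cycles; `H` is the delay plus the induction hypothesis.
    have := E.mdbValue_fresh_le_segmentCost O alg hh hb hcyc hcyc0 hq hlen k.castSucc a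
      (G := fun l => sampleMean (E.winProb k.succ a) h l
        fun l => T * (1 - alarmIndicator (2 * h) b l))
      (fun l => sampleMean_nonneg (E.winProb_mem _ _) hG _ _)
      (H := h * mdbCycle K γ +
        ∑ i ∈ Finset.Ici k.succ, (E.segmentCost γ q alg i + h * mdbCycle K γ))
      (add_nonneg (by positivity) (hcost _))
      (fun n hn => by
        simp_rw [sampleMean_const_mul]
        refine mul_le_mul_of_nonneg_left (le_trans ?_ hq') (Nat.cast_nonneg _)
        refine sampleMean_not_alarm_le (E.winProb_mem _ _) (E.winProb_mem _ _) hn hc ?_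
        exact hδ.trans (mul_le_mul_of_nonneg_left ha (Nat.cast_nonneg _)))
      (fun s hs1 hs2 => by
        have e1 : ((k.castSucc : Fin (N + 1)) : ℕ) + 1 = (k.succ : Fin (N + 1)) := by simp
        rw [e1] at hs1 ⊢
        obtain ⟨x, hx⟩ := Nat.exists_eq_add_of_le hs1
        have hl := hlen k.succ
        have hs := E.segmentEnd_succ k.succ
        have hl' : 2 * (2 * h * mdbCycle K γ) = 4 * (h * mdbCycle K γ) := by ring
        have hst := E.mdbValue_le_of_stale O (2 * h) b γ alg k.succ (e := E.segmentEnd k.succ)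
          (d := E.segmentEnd k.succ + h * mdbCycle K γ)
          ((show _ ≤ E.segmentEnd (k.succ + 1) by omega).trans (E.segmentEnd_le _)) a
          (hcost k.succ) ih (h * mdbCycle K γ) x s (by omega) (by omega)
          (fun t h1 h2 => E.segment_eq (by omega) (by omega)) hs2
        rw [visits_add_mul (lt_of_lt_of_le (O.symm a).2 hcyc), ← hx] at hst
        refine hst.trans (le_of_eq ?_)
        push_cast
        ring) t ht1 ht2
    have e : Finset.Ici k.castSucc = insert k.castSucc (Finset.Ici k.succ) := by
      ext i
      simp only [Finset.mem_Ici, Finset.mem_insert, Fin.le_iff_val_le_val, Fin.ext_iff,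
        Fin.val_castSucc, Fin.val_succ]
      omega
    rw [e, Finset.sum_insert (by simp [Fin.le_iff_val_le_val])]
    linarith

/-- The regret bound of MDB for a window of length `2 h` and an exploration cycle in which all
pairs of arms are played. -/
theorem mdbRegret_le (hh : 0 < h) (hb : 0 ≤ b) {c δ : ℝ} (hc : 0 ≤ c)
    (hcyc : K * (K - 1) / 2 ≤ mdbCycle K γ) (hcyc0 : 0 < mdbCycle K γ)
    (hq : Real.exp (-(b ^ 2 / h)) ≤ q) (hq' : Real.exp (-(h * c ^ 2)) ≤ q)
    (hlen : ∀ m, 2 * (2 * h * mdbCycle K γ) ≤ E.segmentLength m)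
    (hδ : b + c * h ≤ h * δ) (a₀ : ArmPair K)
    (hchange : ∀ k : Fin N, ∃ a, δ ≤ |E.winProb k.castSucc a - E.winProb k.succ a|) :
    E.mdbRegret O (2 * h) b γ alg ≤
      (T / mdbCycle K γ + (N + 1)) * (K * (K - 1) / 2 : ℕ) + T * (T * (2 * q) + (N + 1) * q) +
        (N + 1) * (h * mdbCycle K γ) + E.algRegret alg := by
  have main := E.mdbValue_fresh_le_sum O alg hh hb hc hcyc hcyc0 hq hq' hlen hδ a₀ hchange 0 0
    (by simp [segmentEnd_zero]) (Nat.zero_le _)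
  rw [mdbRegret_eq_mdbValue]
  refine main.trans (le_of_eq ?_)
  have e : Finset.Ici (0 : Fin (N + 1)) = Finset.univ := by ext; simp
  have hT : ∑ m, (E.segmentLength m : ℝ) = T := by exact_mod_cast E.sum_segmentLength
  rw [e]
  simp only [segmentCost, algRegret, expectation_algLaw, Finset.sum_add_distrib, ← Finset.mul_sum,
    ← Finset.sum_mul, ← Finset.sum_div, hT]
  simp
  ring

end MDB

end DuelingEnv

/-! ### The minimal change and crude bounds. -/

namespace DuelingEnv

variable {K T N : ℕ} (E : DuelingEnv K T N)

theorem minimalChange_le_segmentalChange (k : Fin N) : E.minimalChange ≤ E.segmentalChange k :=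
  ciInf_le (Set.finite_range _).bddBelow k

theorem exists_arms_segmentalChange (hK : 0 < K) (k : Fin N) : ∃ i j : Fin K,
    E.segmentalChange k = |E.P k.succ i j - E.P k.castSucc i j| := by
  have : Nonempty (Fin K × Fin K) := ⟨(⟨0, hK⟩, ⟨0, hK⟩)⟩
  obtain ⟨a, ha⟩ := exists_eq_ciSup_of_finite
    (f := fun a : Fin K × Fin K => |E.P k.succ a.1 a.2 - E.P k.castSucc a.1 a.2|)
  exact ⟨a.1, a.2, ha.symm⟩

theorem minimalChange_le_one (hK : 0 < K) (hN : 0 < N) : E.minimalChange ≤ 1 := by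
  refine (E.minimalChange_le_segmentalChange ⟨0, hN⟩).trans ?_
  obtain ⟨i, j, h⟩ := E.exists_arms_segmentalChange hK ⟨0, hN⟩
  rw [h]
  have h1 := E.P_mem (Fin.succ ⟨0, hN⟩) i j
  have h2 := E.P_mem (Fin.castSucc ⟨0, hN⟩) i j
  exact abs_le.2 ⟨by linarith [h1.1, h2.2], by linarith [h1.2, h2.1]⟩

/-- MDB monitors only pairs `i < j`. This suffices: diagonal entries are always 1/2, and swapping
the arms preserves the size of a change. -/
theorem exists_pair_minimalChange_le (hK : 0 < K) (h : 0 < E.minimalChange) (k : Fin N) :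
    ∃ a : ArmPair K, E.minimalChange ≤ |E.winProb k.castSucc a - E.winProb k.succ a| := by
  obtain ⟨i, j, hij⟩ := E.exists_arms_segmentalChange hK k
  have hle := E.minimalChange_le_segmentalChange k
  rw [hij] at hle
  rcases lt_trichotomy i j with hlt | rfl | hlt
  · exact ⟨⟨(i, j), hlt⟩, by rwa [abs_sub_comm]⟩
  · have e1 := E.P_add k.succ i i
    have e2 := E.P_add k.castSucc i i
    rw [show E.P k.succ i i - E.P k.castSucc i i = 0 by linarith, abs_zero] at hle
    linarith
  · refine ⟨⟨(j, i), hlt⟩, hle.trans_eq ?_⟩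
    have e1 := E.P_add k.succ i j
    have e2 := E.P_add k.castSucc i j
    unfold winProb
    congr 1
    linarith

theorem mul_le_horizon {L : ℕ} (h : ∀ m, L ≤ E.segmentLength m) : (N + 1) * L ≤ T := by
  calc (N + 1) * L = ∑ _m : Fin (N + 1), L := by simp
    _ ≤ ∑ m, E.segmentLength m := Finset.sum_le_sum fun m _ => h m
    _ = T := E.sum_segmentLength

theorem mdbRegret_le_horizon (O : Fin (K * (K - 1) / 2) ≃ ArmPair K) (w : ℕ) (b γ : ℝ)
    (alg : DuelingAlg K) : E.mdbRegret O w b γ alg ≤ T := by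
  rw [mdbRegret_eq_mdbValue]
  exact E.mdbValue_le O w b γ alg _ _ _

end DuelingEnv

/-! ### Choice of the parameters. -/

section Parameters

/-- The quotient whose logarithm is the parameter `C`. -/
noncomputable def horizonQuotient (T M K : ℝ) : ℝ := √(2 * T) * (2 * T + 1) / (√M * K)

variable {T M K : ℝ}

/-- Yields `C ≥ 1`, which absorbs the rounding of `w` and the error term without `C`. -/
theorem exp_one_le_horizonQuotient (hM : 1 ≤ M) (hK : 1 ≤ K) (hT : 4 * M * K ≤ T) :
    Real.exp 1 ≤ horizonQuotient T M K := by
  have hMT : M ≤ 2 * T := by nlinarith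
  have hKT : 4 * K ≤ T := by nlinarith
  have h1 := Real.sqrt_le_sqrt hMT
  have h2 : 0 < √M := Real.sqrt_pos.2 (by linarith)
  rw [horizonQuotient, le_div_iff₀ (by positivity)]
  have h3 := Real.exp_one_lt_d9
  calc Real.exp 1 * (√M * K) ≤ 8 * (√M * K) := by
        gcongr; linarith
    _ = √M * (8 * K) := by ring
    _ ≤ √(2 * T) * (2 * T + 1) := by gcongr; linarith

theorem horizonQuotient_le_pow (hM : 1 ≤ M) (hK : 1 ≤ K) (hT : 4 ≤ T) :
    horizonQuotient T M K ≤ T ^ 3 := by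
  have h1 : √(2 * T) ≤ T := Real.sqrt_le_iff.2 ⟨by linarith, by nlinarith⟩
  have h2 : 1 ≤ √M := Real.one_le_sqrt.2 hM
  have h3 : 1 ≤ √M * K := one_le_mul_of_one_le_of_one_le h2 hK
  rw [horizonQuotient]
  calc √(2 * T) * (2 * T + 1) / (√M * K) ≤ √(2 * T) * (2 * T + 1) :=
        div_le_self (by positivity) h3
    _ ≤ T * T ^ 2 := by gcongr; nlinarith
    _ = T ^ 3 := by ring

/-- The reason for the form of `C`: false alarms and misses together cost a multiple of `T²
exp(-C)`. -/
theorem sq_mul_inv_horizonQuotient_le (hM : 1 ≤ M) (hK : 1 ≤ K) (hT : 0 < T) :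
    T ^ 2 * (horizonQuotient T M K)⁻¹ ≤ K * √(M * T) / 2 := by
  have h1 : √T ≤ √(2 * T) := Real.sqrt_le_sqrt (by linarith)
  have h2 : 0 < √T := Real.sqrt_pos.2 hT
  have h3 := Real.mul_self_sqrt hT.le
  rw [horizonQuotient, inv_div, Real.sqrt_mul (show 0 ≤ M by linarith) T, ← mul_div_assoc,
    div_le_iff₀ (by positivity)]
  calc T ^ 2 * (√M * K) = K * (√M * √T) / 2 * (√T * (2 * T)) := by
        linear_combination (-(T * √M * K)) * h3
    _ ≤ _ := by gcongr; linarith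

end Parameters

theorem isLeast_even_le {x : ℝ} (hx : 0 ≤ x) {w : ℕ}
    (hw : IsLeast {v : ℕ | Even v ∧ 2 * x ≤ (v : ℝ)} w) : (w : ℝ) ≤ 2 * x + 2 := by
  have h : w ≤ 2 * ⌈x⌉₊ := hw.2 ⟨even_two_mul _, by push_cast; linarith [Nat.le_ceil x]⟩
  have h1 := Nat.ceil_lt_add_one hx
  have h2 : (w : ℝ) ≤ 2 * ⌈x⌉₊ := by exact_mod_cast h
  linarith

theorem horizon_mul_sqrt_le {T M w C δ Y : ℝ} (hT : 0 < T) (hM : 0 ≤ M) (hC : 0 ≤ C)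
    (hδ : 0 < δ) (hwC : w ≤ 10 * C / δ ^ 2) (hY : Y ^ 2 = M * w / (8 * T)) :
    T * Y ≤ 2 * (√(M * T * C) / δ) := by
  have h1 : T * Y * δ / 2 ≤ √(M * T * C) := by
    refine Real.le_sqrt_of_sq_le ?_
    have h2 : w * δ ^ 2 ≤ 10 * C := (le_div_iff₀ (by positivity)).1 hwC
    have h3 : T ^ 2 * Y ^ 2 = T * M * w / 8 := by rw [hY]; field_simp
    calc (T * Y * δ / 2) ^ 2 = T * M * (w * δ ^ 2) / 32 := by
          linear_combination (δ ^ 2 / 4) * h3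
      _ ≤ T * M * (10 * C) / 32 := by gcongr
      _ ≤ M * T * C := by
          have : 0 ≤ M * T * C := by positivity
          linarith
  rw [← mul_div_assoc, le_div_iff₀ hδ]
  linarith

/-- The upper bound on `γ` keeps the cycle length positive, so that taking the floor loses at most a
factor 2. -/
theorem mdbCycle_bounds {K : ℕ} {γ : ℝ} (hK : 2 ≤ K) (hγ : 0 < γ)
    (hγ' : γ ≤ ((K : ℝ) - 1) / 2) :
    K ≤ mdbCycle K γ ∧ (mdbCycle K γ : ℝ) * (2 * γ) ≤ K * (K - 1) ∧
      (K : ℝ) * (K - 1) ≤ mdbCycle K γ * (4 * γ) := by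
  have hK' : (2 : ℝ) ≤ K := by exact_mod_cast hK
  have hz : (K : ℝ) ≤ K * (K - 1) / (2 * γ) := by
    rw [le_div_iff₀ (by positivity)]
    nlinarith
  have h1 : K ≤ mdbCycle K γ := Nat.le_floor hz
  have h2 : (mdbCycle K γ : ℝ) ≤ K * (K - 1) / (2 * γ) := Nat.floor_le (by linarith)
  have h3 : (K : ℝ) * (K - 1) / (2 * γ) < mdbCycle K γ + 1 := Nat.lt_floor_add_one _
  have h4 : (K : ℝ) ≤ mdbCycle K γ := by exact_mod_cast h1
  refine ⟨h1, (le_div_iff₀ (by positivity)).1 h2, ?_⟩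
  rw [div_lt_iff₀ (by positivity)] at h3
  nlinarith

/-- For such `γ` every cycle is long enough to visit all pairs. -/
theorem le_mdbCycle {K : ℕ} {γ : ℝ} (hK : 1 ≤ K) (hγ : 0 < γ) (hγ1 : γ ≤ 1) :
    K * (K - 1) / 2 ≤ mdbCycle K γ := by
  refine Nat.le_floor ?_
  have hK' : (1 : ℝ) ≤ K := by exact_mod_cast hK
  have h1 : ((K * (K - 1) / 2 : ℕ) : ℝ) ≤ ((K * (K - 1) : ℕ) : ℝ) / 2 := by
    exact_mod_cast Nat.cast_div_le (α := ℝ) (m := K * (K - 1)) (n := 2)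
  have h2 : ((K * (K - 1) : ℕ) : ℝ) = K * (K - 1) := by
    rw [Nat.cast_mul, Nat.cast_sub hK, Nat.cast_one]
  rw [h2] at h1
  refine h1.trans ?_
  have h0 : (0 : ℝ) ≤ K * (K - 1) := mul_nonneg (by linarith) (by linarith)
  gcongr
  linarith

/-- The bound of `DuelingEnv.mdbRegret_le` in terms of `Y = √(M w / (8 T))`. -/
theorem exploration_delay_le {K T N h : ℕ} {γ Y : ℝ} (hK : 2 ≤ K) (hY : 0 < Y) (hT : 0 < T)
    (hγY : γ = ((K : ℝ) - 1) * Y) (hγ' : γ ≤ ((K : ℝ) - 1) / 2)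
    (hY2 : Y ^ 2 = ((N + 1 : ℕ) : ℝ) * ((2 * h : ℕ) : ℝ) / (8 * T))
    (hlen : (N + 1) * mdbCycle K γ ≤ T) :
    ((T : ℝ) / mdbCycle K γ + (N + 1)) * (K * (K - 1) / 2 : ℕ) +
      (N + 1) * (h * mdbCycle K γ) ≤ 6 * (K * (T * Y)) := by
  have hK' : (2 : ℝ) ≤ K := by exact_mod_cast hK
  have hγ : 0 < γ := hγY ▸ mul_pos (by linarith) hY
  obtain ⟨c1, c2, c3⟩ := mdbCycle_bounds hK hγ hγ'
  have hT' : (0 : ℝ) < T := by exact_mod_cast hT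
  have hc0 : (0 : ℝ) < mdbCycle K γ := by exact_mod_cast (by omega : 0 < mdbCycle K γ)
  have hlen' : ((N : ℝ) + 1) * mdbCycle K γ ≤ T := by exact_mod_cast hlen
  have h1 : ((K * (K - 1) / 2 : ℕ) : ℝ) ≤ (K : ℝ) * (K - 1) / 2 := by
    have h1 : ((K * (K - 1) / 2 : ℕ) : ℝ) ≤ ((K * (K - 1) : ℕ) : ℝ) / 2 := by
      exact_mod_cast Nat.cast_div_le (α := ℝ) (m := K * (K - 1)) (n := 2)
    rwa [Nat.cast_mul, Nat.cast_sub (by omega), Nat.cast_one] at h1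
  have h2 : (N : ℝ) + 1 ≤ T / mdbCycle K γ := (le_div_iff₀ hc0).2 hlen'
  have h3 : ((T : ℝ) / mdbCycle K γ + (N + 1)) * (K * (K - 1) / 2 : ℕ) ≤ 4 * (T * γ) := by
    calc _ ≤ ((T : ℝ) / mdbCycle K γ + T / mdbCycle K γ) * (mdbCycle K γ * (4 * γ) / 2) := by
          gcongr
          linarith
      _ = 4 * (T * γ) := by field_simp; ring
  have h4 : (T : ℝ) * γ ≤ K * (T * Y) := by
    rw [hγY]
    nlinarith [mul_pos hT' hY]
  have h5 : ((N : ℝ) + 1) * (h * mdbCycle K γ) ≤ 2 * (K * (T * Y)) := by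
    -- One factor `Y` cancels against the cycle length, which is at most `K / (2Y)`.
    have e1 : ((N : ℝ) + 1) * h = 4 * T * Y ^ 2 := by
      rw [hY2]; push_cast; field_simp; ring
    have e2 : (mdbCycle K γ : ℝ) * (2 * Y) ≤ K := by
      have hK1 : (0 : ℝ) < K - 1 := by linarith
      rw [hγY] at c2
      refine le_of_mul_le_mul_right ?_ hK1
      rw [← hγY] at c2
      rw [hγY] at c2 ⊢
      linarith
    calc ((N : ℝ) + 1) * (h * mdbCycle K γ) = 2 * T * Y * (mdbCycle K γ * (2 * Y)) := by
          rw [← mul_assoc, e1]; ring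
      _ ≤ 2 * T * Y * K := by gcongr
      _ = _ := by ring
  linarith

/-- The choice of the threshold and of the sensitivity for a window of length `2 h`. -/
theorem threshold_bounds {h : ℕ} {C δ b c : ℝ} (hh : 0 < h) (hC : 0 < C) (hδ : 0 < δ)
    (hw : 8 * C / δ ^ 2 ≤ ((2 * h : ℕ) : ℝ)) (hb : b = √(((2 * h : ℕ) : ℝ) * C / 2))
    (hc : c = √(2 * C / ((2 * h : ℕ) : ℝ))) :
    0 < b ∧ 0 < c ∧ b = c * h ∧ 2 * c ≤ δ ∧ h * c ^ 2 = C ∧ b ^ 2 / h = C := by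
  have hh' : (0 : ℝ) < h := by exact_mod_cast hh
  push_cast at hw hb hc
  have hb2 : b ^ 2 = h * C := by
    rw [hb, Real.sq_sqrt (by positivity)]; ring
  have hc2 : h * c ^ 2 = C := by
    rw [hc, Real.sq_sqrt (by positivity)]; field_simp
  have hb0 : 0 < b := hb ▸ Real.sqrt_pos.2 (by positivity)
  have hc0 : 0 < c := hc ▸ Real.sqrt_pos.2 (by positivity)
  refine ⟨hb0, hc0, ?_, ?_, hc2, by rw [hb2]; field_simp⟩
  · refine (pow_left_inj₀ hb0.le (by positivity) two_ne_zero).1 ?_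
    rw [hb2, ← hc2]; ring
  · refine (pow_le_pow_iff_left₀ (by positivity) hδ.le two_ne_zero).1 ?_
    rw [div_le_iff₀ (by positivity), ← hc2] at hw
    refine le_of_mul_le_mul_left ?_ hh'
    nlinarith

/-! ### The regret bounds in terms of the horizon. -/

namespace DuelingEnv

variable {K T N : ℕ} (E : DuelingEnv K T N)

theorem horizon_pos (E : DuelingEnv K T N) (hN : 0 < N) : 0 < T := by
  have h1 := E.one_lt_changepoint ⟨0, hN⟩
  have h2 := E.changepoint_le ⟨0, hN⟩
  omega

theorem mdbRegret_le_mul_sqrt (O : Fin (K * (K - 1) / 2) ≃ ArmPair K) (alg : DuelingAlg K)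
    {h : ℕ} {C γ b c Y : ℝ} (hK : 2 ≤ K) (hN : 0 < N) (hδ : 0 < E.minimalChange)
    (hC : C = Real.log (horizonQuotient T ((N + 1 : ℕ) : ℝ) K)) (hC1 : 1 ≤ C)
    (hh : 0 < h) (hw1 : 8 * C / E.minimalChange ^ 2 ≤ ((2 * h : ℕ) : ℝ))
    (hw2 : ((2 * h : ℕ) : ℝ) ≤ 10 * C / E.minimalChange ^ 2)
    (hY : 0 < Y) (hY2 : Y ^ 2 = ((N + 1 : ℕ) : ℝ) * ((2 * h : ℕ) : ℝ) / (8 * T))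
    (hγ : γ = ((K : ℝ) - 1) * Y) (hγ' : γ ≤ ((K : ℝ) - 1) / 2)
    (hb : b = √(((2 * h : ℕ) : ℝ) * C / 2))
    (hc : c = √(2 * C / ((2 * h : ℕ) : ℝ)))
    (hlen : ∀ m, 2 * (2 * h * mdbCycle K γ) ≤ E.segmentLength m) :
    E.mdbRegret O (2 * h) b γ alg ≤
      14 * (K * √(((N + 1 : ℕ) : ℝ) * T * C) / E.minimalChange) + E.algRegret alg := by
  set δ := E.minimalChange with hδ_def
  have hT : 0 < T := E.horizon_pos hN
  have hT' : (0 : ℝ) < T := by exact_mod_cast hT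
  have hK' : (2 : ℝ) ≤ K := by exact_mod_cast hK
  have hγ0 : 0 < γ := hγ ▸ mul_pos (by linarith) hY
  have hδ1 : δ ≤ 1 := E.minimalChange_le_one (by omega) hN
  have hM1 : (1 : ℝ) ≤ ((N + 1 : ℕ) : ℝ) := by exact_mod_cast Nat.succ_le_succ (Nat.zero_le N)
  obtain ⟨hcK, -, -⟩ := mdbCycle_bounds hK hγ0 hγ'
  have hcyc0 : 0 < mdbCycle K γ := by omega
  have hTY : (K : ℝ) * (T * Y) ≤ 2 * (K * √(((N + 1 : ℕ) : ℝ) * T * C) / δ) := by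
    have h1 := horizon_mul_sqrt_le hT' (by linarith) (by linarith) hδ hw2 hY2
    calc (K : ℝ) * (T * Y) ≤ K * (2 * (√(((N + 1 : ℕ) : ℝ) * T * C) / δ)) := by gcongr
      _ = _ := by ring
  have hX0 : 0 ≤ K * √(((N + 1 : ℕ) : ℝ) * T * C) / δ := by positivity
  by_cases hγ1 : γ ≤ 1
  · obtain ⟨hb0, hc0, hbc, h2c, hq1, hq2⟩ :=
      threshold_bounds hh (by linarith) hδ hw1 hb hc
    have hcyc := le_mdbCycle (K := K) (by omega) hγ0 hγ1
    have main := E.mdbRegret_le O alg hh hb0.le hc0.le hcyc hcyc0 (q := Real.exp (-C))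
      (by rw [hq2]) (by rw [hq1]) hlen (δ := δ) (by rw [hbc]; nlinarith) (O ⟨0, by
        have : 2 * 1 ≤ K * (K - 1) := Nat.mul_le_mul hK (by omega)
        omega⟩)
      (E.exists_pair_minimalChange_le (by omega) hδ)
    have hTL := E.mul_le_horizon hlen
    have hNT : (N + 1) * mdbCycle K γ ≤ T := by
      refine (Nat.mul_le_mul_left _ ?_).trans hTL
      nlinarith
    have h1 := exploration_delay_le hK hY hT hγ hγ' hY2 hNT
    have hquot : 0 < horizonQuotient T ((N + 1 : ℕ) : ℝ) K := by
      unfold horizonQuotient; positivity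
    have hexp : Real.exp (-C) = (horizonQuotient T ((N + 1 : ℕ) : ℝ) K)⁻¹ := by
      rw [Real.exp_neg, hC, Real.exp_log hquot]
    have h2 := sq_mul_inv_horizonQuotient_le (K := K) hM1 (by linarith) hT'
    rw [← hexp] at h2
    have hNT' : (N : ℝ) + 1 ≤ T := by
      have : (N + 1) * 1 ≤ T := (Nat.mul_le_mul_left _ hcyc0).trans hNT
      exact_mod_cast (by omega : N + 1 ≤ T)
    have h3 : (T : ℝ) * (T * (2 * Real.exp (-C)) + (N + 1) * Real.exp (-C)) ≤
        3 * ((T : ℝ) ^ 2 * Real.exp (-C)) := by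
      calc _ ≤ (T : ℝ) * (T * (2 * Real.exp (-C)) + T * Real.exp (-C)) := by gcongr
        _ = _ := by ring
    have h4 : (K : ℝ) * √(((N + 1 : ℕ) : ℝ) * T) ≤ K * √(((N + 1 : ℕ) : ℝ) * T * C) / δ := by
      rw [le_div_iff₀ hδ]
      calc (K : ℝ) * √(((N + 1 : ℕ) : ℝ) * T) * δ ≤ (K : ℝ) * √(((N + 1 : ℕ) : ℝ) * T) :=
            mul_le_of_le_one_right (by positivity) hδ1
        _ ≤ _ := by
            refine mul_le_mul_of_nonneg_left (Real.sqrt_le_sqrt ?_) (by linarith)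
            exact le_mul_of_one_le_right (by positivity) hC1
    -- Exploration and delay give `6 · 2`, the errors `3 · 1/2`, in total at most 14.
    linarith
  -- For `γ > 1` a cycle may omit pairs, but then `T ≤ T γ ≤ K T Y` and the trivial bound suffices.
  · have h1 := E.mdbRegret_le_horizon O (2 * h) b γ alg
    have h2 := E.algRegret_nonneg alg
    have h3 : (T : ℝ) ≤ T * γ := le_mul_of_one_le_right hT'.le (not_le.1 hγ1).le
    have h4 : (T : ℝ) * γ ≤ K * (T * Y) := by
      rw [hγ]
      nlinarith [mul_pos hT' hY]
    linarith

end DuelingEnv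

theorem mul_sqrt_log_le {T ε C y k δ s : ℝ} (hT : 0 < T) (hε : 0 < ε) (hk : 0 ≤ k) (hs : 0 ≤ s)
    (hδ : 0 < δ) (hC : C ≤ 3 * Real.log T) (hy : T ^ ε ≤ y) :
    k * √(s * C) / δ ≤ √(3 / ε) * (k * √(s * Real.log y) / δ) := by
  have h1 : ε * Real.log T ≤ Real.log y := by
    rw [← Real.log_rpow hT]
    exact Real.log_le_log (Real.rpow_pos_of_pos hT ε) hy
  have h2 : C ≤ 3 / ε * Real.log y := by
    have : 3 / ε * (ε * Real.log T) = 3 * Real.log T := by field_simp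
    rw [← this] at hC
    exact hC.trans (by gcongr)
  calc k * √(s * C) / δ ≤ k * √(3 / ε * (s * Real.log y)) / δ := by
        have h3 : s * C ≤ 3 / ε * (s * Real.log y) :=
          (mul_le_mul_of_nonneg_left h2 hs).trans_eq (by ring)
        have h4 := Real.sqrt_le_sqrt h3
        gcongr
    _ = _ := by rw [Real.sqrt_mul (by positivity)]; ring

theorem corollary1 :
    ∃ (A : ℝ) (B : ℝ → ℝ),
      ∀ (K T N : ℕ) (E : DuelingEnv K T N) (O : Fin (K * (K - 1) / 2) ≃ ArmPair K)
        (alg : DuelingAlg K) (M w : ℕ) (δ C γ b c : ℝ),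
        2 ≤ K → 1 ≤ N → M = N + 1 →
        δ = E.minimalChange → 0 < δ →
        C = Real.log (Real.sqrt (2 * (T : ℝ)) * (2 * (T : ℝ) + 1) / (Real.sqrt (M : ℝ) * (K : ℝ))) →
        IsLeast {v : ℕ | Even v ∧ 8 * C / δ ^ 2 ≤ (v : ℝ)} w →
        γ = ((K : ℝ) - 1) * Real.sqrt ((M : ℝ) * (w : ℝ) / (8 * (T : ℝ))) →
        b = Real.sqrt ((w : ℝ) * C / 2) →
        c = Real.sqrt (2 * C / (w : ℝ)) →
        -- every segment has at least `2 L` time steps, where `L` is `w` times the cycle length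
        (∀ m, 2 * (w * mdbCycle K γ) ≤ E.segmentLength m) →
        -- the admissible range of the exploration rate
        γ ∈ Set.Icc ((K : ℝ) * ((K : ℝ) - 1) / (2 * (T : ℝ))) (((K : ℝ) - 1) / 2) →
        -- the parameters are admissible for the detection of changes of size `δ`
        (0 < b ∧ 0 < c ∧ 2 * b / (w : ℝ) + c ≤ δ) ∧
        -- the bound with the logarithm `C`, uniformly in all parameters
        E.mdbRegret O w b γ alg ≤
          A * ((K : ℝ) * Real.sqrt ((M : ℝ) * (T : ℝ) * C) / δ) + E.algRegret alg ∧
        -- the bound with the logarithm `log (δ T / (K M))`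
        ∀ ε : ℝ, 0 < ε → (T : ℝ) ^ ε ≤ δ * (T : ℝ) / ((K : ℝ) * (M : ℝ)) →
          E.mdbRegret O w b γ alg ≤
            B ε * ((K : ℝ) * Real.sqrt
              ((M : ℝ) * (T : ℝ) * Real.log (δ * (T : ℝ) / ((K : ℝ) * (M : ℝ)))) / δ)
              + E.algRegret alg := by
  refine ⟨14, fun ε => 14 * √(3 / ε), ?_⟩
  intro K T N E O alg M w δ C γ b c hK hN hM hδ hδ0 hC hw hγ hb hc hlen hγI
  subst hM hδ
  have hT : 0 < T := E.horizon_pos hN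
  have hT' : (0 : ℝ) < T := by exact_mod_cast hT
  have hK' : (2 : ℝ) ≤ K := by exact_mod_cast hK
  have hM1 : (1 : ℝ) ≤ ((N + 1 : ℕ) : ℝ) := by exact_mod_cast Nat.succ_le_succ (Nat.zero_le N)
  have hγ0 : 0 < γ := lt_of_lt_of_le
    (div_pos (mul_pos (by linarith) (by linarith)) (by positivity)) hγI.1
  set Y := √(((N + 1 : ℕ) : ℝ) * (w : ℝ) / (8 * (T : ℝ))) with hYdef
  have hY : 0 < Y := pos_of_mul_pos_right (hγ ▸ hγ0) (by linarith)
  have hY2 : Y ^ 2 = ((N + 1 : ℕ) : ℝ) * (w : ℝ) / (8 * (T : ℝ)) :=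
    Real.sq_sqrt (by positivity)
  obtain ⟨h, rfl⟩ := hw.1.1.exists_two_nsmul
  rw [smul_eq_mul] at *
  -- An empty window would give `Y = 0`, against the positive lower bound on `γ`.
  have hh : 0 < h := by
    rcases Nat.eq_zero_or_pos h with rfl | hh
    · simp at hY2
      exact absurd hY2 hY.ne'
    · exact hh
  obtain ⟨hcK, -, -⟩ := mdbCycle_bounds hK hγ0 hγI.2
  -- Each segment has at least `4h` cycles of at least `K` steps.
  have hT4 : 4 * ((N + 1 : ℕ) : ℝ) * K ≤ T := by
    have h1 := E.mul_le_horizon hlen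
    have h2 : (N + 1) * (4 * K) ≤ T := by
      refine (Nat.mul_le_mul_left _ ?_).trans h1
      nlinarith
    have h3 : ((N + 1 : ℕ) : ℝ) * (4 * K) ≤ T := by exact_mod_cast h2
    linarith
  have hC' : C = Real.log (horizonQuotient T ((N + 1 : ℕ) : ℝ) K) := hC
  have hquot := exp_one_le_horizonQuotient hM1 (by linarith) hT4
  have hC1 : 1 ≤ C := hC' ▸ (Real.le_log_iff_exp_le ((Real.exp_pos 1).trans_le hquot)).2 hquot
  have hC3 : C ≤ 3 * Real.log T := by
    have := Real.log_le_log ((Real.exp_pos 1).trans_le hquot)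
      (horizonQuotient_le_pow hM1 (by linarith) (by nlinarith : (4 : ℝ) ≤ T))
    rw [Real.log_pow] at this
    exact_mod_cast hC' ▸ this
  have hδ1 : E.minimalChange ≤ 1 := E.minimalChange_le_one (by omega) hN
  -- Rounding up to an even number adds at most 2, which is at most `2C/δ²` as `C ≥ 1` and `δ ≤ 1`.
  have hw2 : ((2 * h : ℕ) : ℝ) ≤ 10 * C / E.minimalChange ^ 2 := by
    have e : 8 * C / E.minimalChange ^ 2 = 2 * (4 * C / E.minimalChange ^ 2) := by ring
    rw [e] at hw
    refine (isLeast_even_le (by positivity) hw).trans ?_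
    have h1 : 2 ≤ 2 * C / E.minimalChange ^ 2 := by
      rw [le_div_iff₀ (by positivity)]
      nlinarith
    calc _ ≤ 2 * (4 * C / E.minimalChange ^ 2) + 2 * C / E.minimalChange ^ 2 := by linarith
      _ = _ := by ring
  obtain ⟨hb0, hc0, hbc, h2c, -, -⟩ := threshold_bounds hh (by linarith) hδ0 hw.1.2 hb hc
  have main := E.mdbRegret_le_mul_sqrt O alg hK hN hδ0 hC' hC1 hh hw.1.2 hw2 hY hY2 hγ hγI.2 hb
    hc hlen
  refine ⟨⟨hb0, hc0, ?_⟩, main, fun ε hε hy => main.trans ?_⟩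
  · have hh' : (0 : ℝ) < h := by exact_mod_cast hh
    have : 2 * b / ((2 * h : ℕ) : ℝ) = c := by
      rw [hbc]; push_cast; field_simp
    linarith
  · have := mul_sqrt_log_le hT' hε (Nat.cast_nonneg K) (by positivity) hδ0 hC3 hy
      (s := ((N + 1 : ℕ) : ℝ) * T)
    linarith
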